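/- **Calculus.** The terms, bags and tests of the λ-calculus with resources and tests ($\tau\partial\lambda$) are given by $$M,N ::= x \mid \lambda x.M \mid M\,B \mid M+N \mid 0 \mid \bar\tau(Q),\qquad B,C ::= [M_1,\dots,M_n;N^!] \mid B+C \mid 0,\qquad Q,R ::= \epsilon \mid Q|R \mid \tau(M) \mid Q+R \mid 0,$$ where the linear part $M_1,\dots,M_n$ of a bag is a finite multiset, $|$ is associative and commutative with unit $\epsilon$, sums are finite formal sums, and all constructors except the bang $(\cdot)^!$ distribute over sums. An omitted banged argument means $0^!$. The λ-calculus with resources ($\partial\lambda$) is the part without $\tau,\bar\tau$ and tests. Linear substitution $M\langle N/x\rangle$ is the sum, over all linear occurrences of $x$ in $M$, of the replacements of that occurrence by $N$, where a bang first provides a linear copy: $[\vec M;L^!]\langle N/x\rangle=\sum_i[M_1,\dots,M_i\langle N/x\rangle,\dots,M_n;L^!]+[\vec M,L\langle N/x\rangle;L^!]$; similarly, $(Q|R)\langle N/x\rangle=(Q\langle N/x\rangle)|R+Q|(R\langle N/x\rangle)$. The reduction rules are $$(\lambda x.M)[N_1,\dots,N_n;N^!]\to M\langle N_1/x\rangle\cdots\langle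 N_n/x\rangle\{N/x\},\quad \tau(\bar\tau(Q))\to Q,\quad \tau(\lambda x.M)\to\tau(M\{0/x\}),$$ $$\bar\tau(Q)\,[M^!]\to\bar\tau(Q),\qquad \bar\tau(Q)\,[M_1,\dots,M_n;M^!]\to 0\ \ (n\ge1).$$ Outer-head reduction contracts, in some summand, the redex in head position, and once the head is a variable it reduces (in the same way) the linear arguments; nothing is reduced under a bang. The simple (sum-free) outer-head normal forms are the terms $\lambda\bar x.\,y\,[\vec N_1;L_1^!]\cdots[\vec N_k;L_k^!]$ with all terms in the $\vec N_i$ in outer-head normal form, the terms $\lambda\bar x.\bar\tau(Q)$ with $Q$ in outer-head normal form, and the tests $\tau(N_1)|\cdots|\tau(N_m)$, $m\ge0$, where each $N_i$ is a normal form of the first kind without leading abstraction. A term or test *converges* if it outer-head reduces to a sum with at least one summand in outer-head normal form. In either calculus, $M$ is observationally below $N$ if for every context $C$ of that calculus (with one hole, possibly capturing variables, the output being a term or, in $\tau\partial\lambda$, a term or a test), $C[N]$ converges whenever $C[M]$ converges. Write $\le_\partial$, $\le_{\tau\partial}$ for these preorders and $\equiv_\partial$ for the equivalence of $\le_\partial$.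 **Model.** $\mathcal M_\infty$ is the reflexive object of $\mathbf{MRel}$ whose points are the almost everywhere empty sequences of finite multisets of points, defined inductively: points are generated by $*$ (the everywhere empty sequence) and $a::\alpha$ ($a$ a finite multiset of points, $\alpha$ a point), with $[]::*=*$. The interpretation is $[\![M]\!]=\{(\Gamma,\alpha)\mid\Gamma\vdash M:\alpha\}$, where environments $\Gamma$ assign finite multisets of points to variables and are added pointwise, and: $x:[\alpha]\vdash x:\alpha$; if $\Gamma,x:v\vdash M:\alpha$ then $\Gamma\vdash\lambda x.M:v::\alpha$; if $\Gamma\vdash M:w::\alpha$ and $\Gamma'\vdash B:w$ then $\Gamma+\Gamma'\vdash M\,B:\alpha$; if $\Gamma_j\vdash L_j:\beta_j$ for $j\le n$ and $\Gamma_j\vdash L:\beta_j$ for $n<j\le n+m$ $(m\ge0)$ then $\sum_j\Gamma_j\vdash[L_1,\dots,L_n;L^!]:[\beta_1,\dots,\beta_{n+m}]$; a sum has every type that one of its summands has; if $\Gamma\vdash Q$ then $\Gamma\vdash\bar\tau(Q):*$; if $\Gamma\vdash M:*$ then $\Gamma\vdash\tau(M)$; if $\Gamma\vdash Q$ and $\Gamma'\vdash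 R$ then $\Gamma+\Gamma'\vdash Q|R$; and $\vdash\epsilon$. **Theorem.** $\mathcal M_\infty$ is not fully abstract for the λ-calculus with resources: it is not the case that $[\![M]\!]=[\![N]\!]\Leftrightarrow M\equiv_\partial N$ for all closed terms $M,N$ of $\partial\lambda$. More precisely, denotational equality is strictly finer than observational equivalence: let $I=\lambda x.x$, $$\Theta=(\lambda gu.\,u\,[(g\,[g^!]\,[u^!])^!])\,[(\lambda gu.\,u\,[(g\,[g^!]\,[u^!])^!])^!]$$ (Turing's fixpoint combinator) and $$A=\Theta\,[\lambda uvw.\,w\,[I\,[v^!]]\,;\,(\lambda uvw.\,u\,[(v\,[w^!])^!])^!].$$ Then: 1. for all terms $M,N$ of $\partial\lambda$, $[\![M]\!]=[\![N]\!]$ implies $M\equiv_\partial N$; 2. $A+I$ and $A$ are closed terms of $\partial\lambda$ with $A+I\equiv_\partial A$ but $[\![A+I]\!]\ne[\![A]\!]$; 3. $I\le_\partial A$, but $I\not\le_{\tau\partial}A$. -/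

import Mathlib

namespace ResourceCalculus

/-! ## Syntax

Terms, bags and tests are represented in the form in which all sums have been distributed over
linear positions: an expression is a finite formal sum of *simple* expressions.  A finite sum,
and also the linear part of a bag and a parallel composition of tests, is a finite multiset, and
is represented by any list that enumerates it.  Variables are de Bruijn indices. -/

/-- Simple terms of the λ-calculus with resources and tests.
* `var n` is a variable and `lam s` an abstraction;
* `app s L N` is the application `s [L₁,…,Lₙ ; (N₁ + ⋯ + Nₖ)!]` of `s` to a simple bag with the
  linear arguments `L` and the (possibly empty) sum `N` under the bang;
* `taubar Q` is `τ̄(τ(Q₁) | ⋯ | τ(Qₘ))`; the empty parallel composition is the test `ε`. -/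
inductive Tm : Type
  | var : ℕ → Tm
  | lam : Tm → Tm
  | app : Tm → List Tm → List Tm → Tm
  | taubar : List Tm → Tm

/-- A term is a finite sum of simple terms; `0` is `[]` and `+` is `++`. -/
abbrev Term : Type := List Tm

/-- A simple bag `[L₁,…,Lₙ ; N!]` is the pair `(L, N)`. -/
abbrev SBag : Type := List Tm × Term

/-- A bag is a finite sum of simple bags. -/
abbrev Bag : Type := List SBag

/-- A simple test `τ(M₁) | ⋯ | τ(Mₘ)` is the list of the simple terms `Mᵢ`; `ε` is `[]`. -/
abbrev STest : Type := List Tm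

/-- A test is a finite sum of simple tests. -/
abbrev Test : Type := List STest

/-! The constructors of the grammar, extended to sums by distributivity. -/

/-- `λx.(Σᵢ Mᵢ) = Σᵢ λx.Mᵢ`. -/
def Term.lam (M : Term) : Term := M.map Tm.lam

/-- `(Σᵢ Mᵢ) (Σⱼ Bⱼ) = Σᵢⱼ (Mᵢ Bⱼ)`. -/
def Term.app (M : Term) (P : Bag) : Term :=
  M.flatMap fun s => P.map fun b => Tm.app s b.1 b.2

/-- The bag `[M₁,…,Mₙ ; N!]` whose linear arguments `Mⱼ` are sums: the sum, over all choices of one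
summand in each `Mⱼ`, of the corresponding simple bags. -/
def Bag.mk (L : List Term) (N : Term) : Bag := L.sections.map fun l => (l, N)

/-- `τ̄(Σᵢ Qᵢ) = Σᵢ τ̄(Qᵢ)`. -/
def Term.taubar (Q : Test) : Term := Q.map Tm.taubar

/-- `τ(Σᵢ Mᵢ) = Σᵢ τ(Mᵢ)`. -/
def Test.tau (M : Term) : Test := M.map fun s => [s]

/-- `(Σᵢ Qᵢ) | (Σⱼ Rⱼ) = Σᵢⱼ (Qᵢ | Rⱼ)`. -/
def Test.par (Q R : Test) : Test := Q.flatMap fun q => R.map fun r => q ++ r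

/-! Simple terms without tests, and free variables. -/

/-- The simple terms of the λ-calculus with resources: those in which `τ̄` (hence also `τ`) does
not occur. -/
inductive Tm.IsResource : Tm → Prop
  | var (n : ℕ) : Tm.IsResource (.var n)
  | lam {s : Tm} : Tm.IsResource s → Tm.IsResource (.lam s)
  | app {s : Tm} {L N : List Tm} : Tm.IsResource s → (∀ t ∈ L, Tm.IsResource t) →
      (∀ t ∈ N, Tm.IsResource t) → Tm.IsResource (.app s L N)

/-- `s.FreeBelow k`: all free variables of `s` have index `< k`. -/
inductive Tm.FreeBelow : ℕ → Tm → Prop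
  | var {k n : ℕ} : n < k → Tm.FreeBelow k (.var n)
  | lam {k : ℕ} {s : Tm} : Tm.FreeBelow (k + 1) s → Tm.FreeBelow k (.lam s)
  | app {k : ℕ} {s : Tm} {L N : List Tm} : Tm.FreeBelow k s → (∀ t ∈ L, Tm.FreeBelow k t) →
      (∀ t ∈ N, Tm.FreeBelow k t) → Tm.FreeBelow k (.app s L N)
  | taubar {k : ℕ} {Q : List Tm} : (∀ t ∈ Q, Tm.FreeBelow k t) → Tm.FreeBelow k (.taubar Q)

/-- Terms of the λ-calculus with resources. -/
def Term.IsResource (M : Term) : Prop := ∀ s ∈ M, s.IsResource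

/-- Bags of the λ-calculus with resources. -/
def Bag.IsResource (P : Bag) : Prop :=
  ∀ b ∈ P, (∀ s ∈ b.1, s.IsResource) ∧ Term.IsResource b.2

/-- Closed terms. -/
def Term.IsClosed (M : Term) : Prop := ∀ s ∈ M, s.FreeBelow 0

/-! ## Substitutions -/

mutual
/-- Renaming of free variables. -/
def Tm.rename (f : ℕ → ℕ) : Tm → Tm
  | .var n => .var (f n)
  | .lam s => .lam (Tm.rename (fun n => Nat.casesOn n 0 fun m => f m + 1) s)
  | .app s L N => .app (Tm.rename f s) (Tm.renameList f L) (Tm.renameList f N)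
  | .taubar Q => .taubar (Tm.renameList f Q)
/-- Renaming in each entry of a list. -/
def Tm.renameList (f : ℕ → ℕ) : List Tm → List Tm
  | [] => []
  | s :: L => Tm.rename f s :: Tm.renameList f L
end

/-- Weakening: all free variables are shifted by one. -/
def Tm.shift (s : Tm) : Tm := s.rename Nat.succ

mutual
/-- Linear substitution `s⟨t/x⟩` of the simple term `t` for exactly one occurrence of `x`:
the sum over all linear occurrences, where a sum under a bang first yields a linear copy. -/
def Tm.lsubst (x : ℕ) (t : Tm) : Tm → Term
  | .var n => if n = x then [t] else []
  | .lam s => (Tm.lsubst (x + 1) t.shift s).map Tm.lam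
  | .app s L N =>
      (Tm.lsubst x t s).map (fun s' => Tm.app s' L N)
        ++ (Tm.lsubstOne x t L).map (fun L' => Tm.app s L' N)
        ++ (Tm.lsubstSum x t N).map (fun u => Tm.app s (u :: L) N)
  | .taubar Q => (Tm.lsubstOne x t Q).map Tm.taubar
/-- Linear substitution in exactly one of the entries of a list of linear components. -/
def Tm.lsubstOne (x : ℕ) (t : Tm) : List Tm → List (List Tm)
  | [] => []
  | s :: L => (Tm.lsubst x t s).map (fun s' => s' :: L)
      ++ (Tm.lsubstOne x t L).map (fun L' => s :: L')
/-- Linear substitution in a sum of simple terms. -/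
def Tm.lsubstSum (x : ℕ) (t : Tm) : List Tm → Term
  | [] => []
  | s :: N => Tm.lsubst x t s ++ Tm.lsubstSum x t N
end

/-- A substitution of sums for variables, carried under a binder. -/
def liftSubst (σ : ℕ → Term) : ℕ → Term
  | 0 => [.var 0]
  | n + 1 => (σ n).map Tm.shift

mutual
/-- The usual (simultaneous, capture-avoiding) substitution of the terms `σ n` for the variables
`n`, distributing the sums out of the linear positions. -/
def Tm.subst (σ : ℕ → Term) : Tm → Term
  | .var n => σ n
  | .lam s => Term.lam (Tm.subst (liftSubst σ) s)
  | .app s L N =>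
      Term.app (Tm.subst σ s) (Bag.mk (Tm.substEach σ L) (Tm.substSum σ N))
  | .taubar Q => (Tm.substEach σ Q).sections.map Tm.taubar
/-- Substitution in each entry of a list of linear components. -/
def Tm.substEach (σ : ℕ → Term) : List Tm → List Term
  | [] => []
  | s :: L => Tm.subst σ s :: Tm.substEach σ L
/-- Substitution in a sum of simple terms. -/
def Tm.substSum (σ : ℕ → Term) : List Tm → Term
  | [] => []
  | s :: N => Tm.subst σ s ++ Tm.substSum σ N
end

/-- The substitution `{N/x}` for the outermost bound variable `x`, which disappears. -/
def single (N : Term) : ℕ → Term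
  | 0 => N
  | n + 1 => [.var n]

/-- The β-contractum `M⟨L₁/x⟩⋯⟨Lₙ/x⟩{N/x}` of `(λx.M) [L₁,…,Lₙ ; N!]`. -/
def Tm.beta (s : Tm) (L : List Tm) (N : Term) : Term :=
  (L.foldl (fun (S : Term) t => S.flatMap (Tm.lsubst 0 t.shift)) [s]).flatMap
    (Tm.subst (single N))

/-! ## Outer-head reduction and convergence -/

/-- The head of the simple term is a variable, and there is no abstraction in front of it. -/
inductive Tm.VarHeaded : Tm → Prop
  | var (n : ℕ) : Tm.VarHeaded (.var n)
  | app {s : Tm} (L N : List Tm) : Tm.VarHeaded s → Tm.VarHeaded (.app s L N)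

mutual
/-- One step of outer-head reduction, from a simple term to a sum: the redex in head position is
contracted if there is one; linear arguments are reduced only once the head is a variable.
Nothing is reduced under a bang. -/
inductive Tm.Step : Tm → Term → Prop
  | beta (s : Tm) (L N : List Tm) : Tm.Step (.app (.lam s) L N) (Tm.beta s L N)
  | taubar_bang (Q N : List Tm) : Tm.Step (.app (.taubar Q) [] N) [.taubar Q]
  | taubar_lin (Q : List Tm) (t : Tm) (L N : List Tm) :
      Tm.Step (.app (.taubar Q) (t :: L) N) []
  | lam {s : Tm} {S : Term} : Tm.Step s S → Tm.Step (.lam s) (S.map Tm.lam)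
  | head {s : Tm} {L N : List Tm} {S : Term} (L' N' : List Tm) : Tm.Step (.app s L N) S →
      Tm.Step (.app (.app s L N) L' N') (S.map fun s' => Tm.app s' L' N')
  | arg {s t : Tm} {S : Term} (L₁ L₂ N : List Tm) : Tm.VarHeaded s → Tm.Step t S →
      Tm.Step (.app s (L₁ ++ t :: L₂) N) (S.map fun t' => Tm.app s (L₁ ++ t' :: L₂) N)
  | taubar {Q : STest} {S : Test} : STest.Step Q S → Tm.Step (.taubar Q) (S.map Tm.taubar)
/-- One step of outer-head reduction, from a simple test to a sum. -/
inductive STest.Step : STest → Test → Prop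
  | gamma (Q₁ R Q₂ : STest) : STest.Step (Q₁ ++ .taubar R :: Q₂) [Q₁ ++ R ++ Q₂]
  | tau (Q₁ : STest) (s : Tm) (Q₂ : STest) :
      STest.Step (Q₁ ++ .lam s :: Q₂)
        ((Tm.subst (single []) s).map fun s' => Q₁ ++ s' :: Q₂)
  | head {s : Tm} {L N : List Tm} {S : Term} (Q₁ Q₂ : STest) : Tm.Step (.app s L N) S →
      STest.Step (Q₁ ++ .app s L N :: Q₂) (S.map fun s' => Q₁ ++ s' :: Q₂)
end

mutual
/-- Variable-headed outer-head normal forms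
`y [N₁₁,…,N₁ₖ₁ ; L₁!] ⋯ [Nₙ₁,…,Nₙₖₙ ; Lₙ!]`, with all `Nᵢⱼ` in outer-head normal form. -/
inductive Tm.Neutral : Tm → Prop
  | var (n : ℕ) : Tm.Neutral (.var n)
  | app {s : Tm} {L : List Tm} (N : List Tm) : Tm.Neutral s → (∀ t ∈ L, Tm.Normal t) →
      Tm.Neutral (.app s L N)
/-- Simple terms in outer-head normal form: abstractions over a variable-headed normal form or
over `τ̄(Q)` with `Q` in outer-head normal form, i.e. a parallel composition of tests `τ(N)` that
cannot be reduced, which means that each `N` is a variable-headed normal form. -/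
inductive Tm.Normal : Tm → Prop
  | neutral {s : Tm} : Tm.Neutral s → Tm.Normal s
  | taubar {Q : STest} : (∀ t ∈ Q, Tm.Neutral t) → Tm.Normal (.taubar Q)
  | lam {s : Tm} : Tm.Normal s → Tm.Normal (.lam s)
end

/-- Simple tests in outer-head normal form. -/
def STest.Normal (Q : STest) : Prop := ∀ t ∈ Q, Tm.Neutral t

/-- One step of outer-head reduction of a term: one of its summands is reduced. -/
inductive Term.Step : Term → Term → Prop
  | mk {s : Tm} {S : Term} (U V : Term) : Tm.Step s S → Term.Step (U ++ s :: V) (U ++ S ++ V)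

/-- One step of outer-head reduction of a test: one of its summands is reduced. -/
inductive Test.Step : Test → Test → Prop
  | mk {q : STest} {S : Test} (U V : Test) : STest.Step q S → Test.Step (U ++ q :: V) (U ++ S ++ V)

/-- A term is outer-head converging if it reduces to a sum in which some summand is in outer-head
normal form. -/
def Term.Converges (M : Term) : Prop :=
  ∃ M' : Term, Relation.ReflTransGen Term.Step M M' ∧ ∃ s ∈ M', Tm.Normal s

/-- A test is outer-head converging if it reduces to a sum in which some summand is in outer-head
normal form. -/
def Test.Converges (Q : Test) : Prop :=
  ∃ Q' : Test, Relation.ReflTransGen Test.Step Q Q' ∧ ∃ q ∈ Q', STest.Normal q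

/-! ## Contexts and the observational orders -/

mutual
/-- Contexts (with one hole for a term) whose output is a term. -/
inductive TermCtx : Type
  | hole : TermCtx
  | lam : TermCtx → TermCtx
  | appLeft : TermCtx → Bag → TermCtx
  | appRight : Term → BagCtx → TermCtx
  | add : TermCtx → Term → TermCtx
  | taubar : TestCtx → TermCtx
/-- Contexts whose output is a bag: `[C, L₁,…,Lₙ ; N!]`, `[L₁,…,Lₙ ; C!]` and `D + P`. -/
inductive BagCtx : Type
  | lin : TermCtx → List Term → Term → BagCtx
  | bang : List Term → TermCtx → BagCtx
  | add : BagCtx → Bag → BagCtx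
/-- Contexts whose output is a test. -/
inductive TestCtx : Type
  | tau : TermCtx → TestCtx
  | par : TestCtx → Test → TestCtx
  | add : TestCtx → Test → TestCtx
end

mutual
/-- `C⟦M⟧`: the hole is filled with `M`, possibly capturing free variables of `M`. -/
def TermCtx.plug (M : Term) : TermCtx → Term
  | .hole => M
  | .lam C => Term.lam (TermCtx.plug M C)
  | .appLeft C P => Term.app (TermCtx.plug M C) P
  | .appRight N D => Term.app N (BagCtx.plug M D)
  | .add C N => TermCtx.plug M C ++ N
  | .taubar K => Term.taubar (TestCtx.plug M K)
/-- Filling the hole of a bag context. -/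
def BagCtx.plug (M : Term) : BagCtx → Bag
  | .lin C L N => Bag.mk (TermCtx.plug M C :: L) N
  | .bang L C => Bag.mk L (TermCtx.plug M C)
  | .add D P => BagCtx.plug M D ++ P
/-- Filling the hole of a test context. -/
def TestCtx.plug (M : Term) : TestCtx → Test
  | .tau C => Test.tau (TermCtx.plug M C)
  | .par K R => Test.par (TestCtx.plug M K) R
  | .add K R => TestCtx.plug M K ++ R
end

mutual
/-- The contexts of the λ-calculus with resources (without tests). -/
inductive TermCtx.IsResource : TermCtx → Prop
  | hole : TermCtx.IsResource .hole
  | lam {C : TermCtx} : TermCtx.IsResource C → TermCtx.IsResource (.lam C)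
  | appLeft {C : TermCtx} {P : Bag} : TermCtx.IsResource C → P.IsResource →
      TermCtx.IsResource (.appLeft C P)
  | appRight {N : Term} {D : BagCtx} : N.IsResource → BagCtx.IsResource D →
      TermCtx.IsResource (.appRight N D)
  | add {C : TermCtx} {N : Term} : TermCtx.IsResource C → N.IsResource →
      TermCtx.IsResource (.add C N)
/-- The bag contexts of the λ-calculus with resources. -/
inductive BagCtx.IsResource : BagCtx → Prop
  | lin {C : TermCtx} {L : List Term} {N : Term} : TermCtx.IsResource C →
      (∀ M ∈ L, Term.IsResource M) → N.IsResource → BagCtx.IsResource (.lin C L N)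
  | bang {L : List Term} {C : TermCtx} : (∀ M ∈ L, Term.IsResource M) →
      TermCtx.IsResource C → BagCtx.IsResource (.bang L C)
  | add {D : BagCtx} {P : Bag} : BagCtx.IsResource D → P.IsResource →
      BagCtx.IsResource (.add D P)
end

/-- The observational order of the λ-calculus with resources. -/
def ObsLE (M N : Term) : Prop :=
  ∀ C : TermCtx, C.IsResource → (C.plug M).Converges → (C.plug N).Converges

/-- The observational equivalence of the λ-calculus with resources. -/
def ObsEquiv (M N : Term) : Prop := ObsLE M N ∧ ObsLE N M

/-- The observational order of the λ-calculus with resources and tests. -/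
def ObsLETests (M N : Term) : Prop :=
  (∀ C : TermCtx, (C.plug M).Converges → (C.plug N).Converges) ∧
    ∀ K : TestCtx, (K.plug M).Converges → (K.plug N).Converges

/-! ## The reflexive object `M∞` of `MRel`

Its points are the infinite sequences of finite multisets of points that are almost everywhere
empty, in the least sense: they are generated by the everywhere empty sequence `*` and by
`a :: α`, with `a` a finite multiset of points and `α` a point, subject only to `[] :: * = *`. -/

/-- Notations for points of `M∞`. -/
inductive PrePoint : Type
  | star : PrePoint
  | cons : List PrePoint → PrePoint → PrePoint

/-- Two notations related by `Rel` denote the same point. -/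
inductive PrePoint.Rel : PrePoint → PrePoint → Prop
  | star : PrePoint.Rel (.cons [] .star) .star
  | perm {l l' : List PrePoint} (p : PrePoint) : l.Perm l' →
      PrePoint.Rel (.cons l p) (.cons l' p)
  | entry {p q : PrePoint} (l₁ l₂ : List PrePoint) (r : PrePoint) : PrePoint.Rel p q →
      PrePoint.Rel (.cons (l₁ ++ p :: l₂) r) (.cons (l₁ ++ q :: l₂) r)
  | tail {p q : PrePoint} (l : List PrePoint) : PrePoint.Rel p q →
      PrePoint.Rel (.cons l p) (.cons l q)

/-- The set underlying the reflexive object `M∞`. -/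
def MInf : Type := Quot PrePoint.Rel

namespace MInf

/-- The point denoted by a notation. -/
def ofPre (p : PrePoint) : MInf := Quot.mk _ p

/-- A notation for a point. -/
noncomputable def toPre (x : MInf) : PrePoint := Quot.out x

theorem ofPre_toPre (x : MInf) : ofPre x.toPre = x := Quot.out_eq x

/-- The point `*`. -/
def star : MInf := ofPre .star

/-- The point `a :: α`. -/
noncomputable def cons (a : Multiset MInf) (α : MInf) : MInf :=
  ofPre (.cons (a.toList.map toPre) α.toPre)

/-- The first entry and the remainder of a sequence. -/
def dest : MInf → Multiset MInf × MInf :=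
  Quot.lift
    (fun p => match p with
      | .star => (0, star)
      | .cons l p => (Multiset.ofList (l.map ofPre), ofPre p))
    (by
      intro p q h
      cases h with
      | star => rfl
      | perm r h => exact Prod.ext (Quot.sound (h.map _)) rfl
      | @entry p q l₁ l₂ r h =>
        have : ofPre p = ofPre q := Quot.sound h
        simp [this]
      | @tail p q l h =>
        have : ofPre p = ofPre q := Quot.sound h
        simp [this])

theorem dest_cons (a : Multiset MInf) (α : MInf) : dest (cons a α) = (a, α) := by
  have h : ofPre ∘ toPre = id := funext ofPre_toPre
  change (Multiset.ofList ((a.toList.map toPre).map ofPre), ofPre α.toPre) = (a, α)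
  rw [List.map_map, h, List.map_id, Multiset.coe_toList, ofPre_toPre]

theorem ofPre_cons_tail (l : List PrePoint) {p q : PrePoint} (h : ofPre p = ofPre q) :
    ofPre (.cons l p) = ofPre (.cons l q) := by
  have := Quot.eqvGen_exact h
  clear h
  induction this with
  | rel x y h => exact Quot.sound (.tail _ h)
  | refl x => rfl
  | symm x y _ ih => exact ih.symm
  | trans x y z _ _ ih₁ ih₂ => exact ih₁.trans ih₂

theorem ofPre_cons_entry {p q : PrePoint} (l₁ l₂ : List PrePoint) (r : PrePoint)
    (h : ofPre p = ofPre q) :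
    ofPre (.cons (l₁ ++ p :: l₂) r) = ofPre (.cons (l₁ ++ q :: l₂) r) := by
  have := Quot.eqvGen_exact h
  clear h
  induction this with
  | rel x y h => exact Quot.sound (.entry _ _ _ h)
  | refl x => rfl
  | symm x y _ ih => exact ih.symm
  | trans x y z _ _ ih₁ ih₂ => exact ih₁.trans ih₂

theorem ofPre_cons_toPre (p : PrePoint) (l₀ l : List PrePoint) :
    ofPre (.cons (l₀ ++ l) p) = ofPre (.cons (l₀ ++ (l.map ofPre).map toPre) p) := by
  induction l generalizing l₀ with
  | nil => rfl
  | cons x l ih =>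
    have h := ih (l₀ ++ [(ofPre x).toPre])
    simp only [List.append_assoc, List.singleton_append] at h
    exact (ofPre_cons_entry l₀ l p (ofPre_toPre (ofPre x)).symm).trans h

theorem ofPre_cons (l : List PrePoint) (p : PrePoint) :
    ofPre (.cons l p) = cons (Multiset.ofList (l.map ofPre)) (ofPre p) := by
  have hp : ((l.map ofPre).map toPre).Perm
      ((Multiset.ofList (l.map ofPre)).toList.map toPre) := by
    refine List.Perm.map _ ?_
    rw [← Multiset.coe_eq_coe, Multiset.coe_toList]
  exact (ofPre_cons_toPre p [] l).trans ((Quot.sound (.perm p hp)).trans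
    (ofPre_cons_tail _ (ofPre_toPre (ofPre p)).symm))

theorem cons_zero_star : cons 0 star = star :=
  (ofPre_cons [] .star).symm.trans (Quot.sound .star)

theorem cons_dest (x : MInf) : cons (dest x).1 (dest x).2 = x := by
  induction x using Quot.ind with
  | mk p =>
    cases p with
    | star => exact cons_zero_star
    | cons l p => exact (ofPre_cons l p).symm

/-- The reflexive structure: `M∞` is isomorphic to `M∞ ⇒ M∞ = M_f(M∞) × M∞`; the two directions
are the abstraction and the application of the reflexive object. -/
noncomputable def absApp : Multiset MInf × MInf ≃ MInf where
  toFun x := cons x.1 x.2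
  invFun := dest
  left_inv x := dest_cons x.1 x.2
  right_inv := cons_dest

end MInf

/-! ## The interpretation in `M∞`, as a type system -/

/-- Type environments; a variable that is not used has the empty multiset of types. -/
abbrev Env : Type := ℕ → Multiset MInf

/-- The environment `Γ, x : v`, where `x` is the new variable `0`. -/
def Env.extend (v : Multiset MInf) (Γ : Env) : Env
  | 0 => v
  | n + 1 => Γ n

mutual
/-- `Γ ⊢ s : α` for a simple term `s`. -/
inductive HasType : Env → Tm → MInf → Prop
  | var (n : ℕ) (α : MInf) : HasType (Pi.single n {α}) (.var n) α
  | lam {Γ : Env} {v : Multiset MInf} {s : Tm} {α : MInf} :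
      HasType (Env.extend v Γ) s α → HasType Γ (.lam s) (MInf.cons v α)
  | app {Γ Δ : Env} {s : Tm} {L N : List Tm} {w : Multiset MInf} {α : MInf} :
      HasType Γ s (MInf.cons w α) → BagHasType Δ L N w → HasType (Γ + Δ) (.app s L N) α
  | taubar {Γ : Env} {Q : STest} : TestTyped Γ Q → HasType Γ (.taubar Q) MInf.star
/-- `Γ ⊢ [L₁,…,Lₙ ; N!] : w`: each linear argument is typed exactly once, the sum under the bang
any finite number of times, each time through one of its summands. -/
inductive BagHasType : Env → List Tm → List Tm → Multiset MInf → Prop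
  | nil (N : List Tm) : BagHasType 0 [] N 0
  | bang {Γ Δ : Env} {t : Tm} {N : List Tm} {β : MInf} {w : Multiset MInf} : t ∈ N →
      HasType Γ t β → BagHasType Δ [] N w → BagHasType (Γ + Δ) [] N (β ::ₘ w)
  | lin {Γ Δ : Env} {t : Tm} {L N : List Tm} {β : MInf} {w : Multiset MInf} :
      HasType Γ t β → BagHasType Δ L N w → BagHasType (Γ + Δ) (t :: L) N (β ::ₘ w)
/-- `Γ ⊢ Q` for a simple test `Q`. -/
inductive TestTyped : Env → STest → Prop
  | eps : TestTyped 0 []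
  | par {Γ Δ : Env} {t : Tm} {Q : STest} :
      HasType Γ t MInf.star → TestTyped Δ Q → TestTyped (Γ + Δ) (t :: Q)
end

/-- The interpretation of a term in `M∞`: the relation `{(Γ, α) | Γ ⊢ M : α}`, where a sum is
typed through any of its summands. -/
def interp (M : Term) : Set (Env × MInf) := {p | ∃ s ∈ M, HasType p.1 s p.2}

/-- `M∞` is fully abstract for the λ-calculus with resources: on closed terms, equality of the
interpretations is observational equivalence. -/
def FullyAbstract : Prop :=
  ∀ M N : Term, M.IsResource → M.IsClosed → N.IsResource → N.IsClosed →
    (interp M = interp N ↔ ObsEquiv M N)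

/-! ## The terms of the counter-example -/

/-- `I = λx. x`. -/
def tmI : Tm := .lam (.var 0)

/-- `λg u. u [(g [g!] [u!])!]`. -/
def tmG : Tm :=
  .lam (.lam (.app (.var 0) [] [.app (.app (.var 1) [] [.var 1]) [] [.var 0]]))

/-- Turing's fixpoint combinator `Θ = (λg u. u [(g [g!] [u!])!]) [(λg u. u [(g [g!] [u!])!])!]`. -/
def tmTheta : Tm := .app tmG [] [tmG]

/-- `λu v w. w [I [v!]]`. -/
def tmF : Tm := .lam (.lam (.lam (.app (.var 0) [.app tmI [] [.var 1]] [])))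

/-- `λu v w. u [(v [w!])!]`. -/
def tmH : Tm := .lam (.lam (.lam (.app (.var 2) [] [.app (.var 1) [] [.var 0]])))

/-- `A = Θ [λu v w. w [I [v!]] ; (λu v w. u [(v [w!])!])!]`. -/
def tmA : Tm := .app tmTheta [tmF] [tmH]

end ResourceCalculus

open ResourceCalculus

namespace ResourceCalculus

-- Unfolding the fixpoint, `A` behaves like the infinite sum, over `n ≥ 0`, of the terms `λv w₁ … wₙ
-- w. w [I [(v [w₁!] ⋯ [wₙ!])!]]`: it acts like the identity, except that after `n` arguments it
-- waits for one more, which is used linearly, as the head. In `M∞` the identity has type `[*] ::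
-- *`. Since `* = [] :: *`, a type `v :: *` assigns `[]` to every later argument, so no component of
-- `A` can have it (`not_den_tmA`). A test can require exactly such a type, and `τ(□ [τ̄(ε)!])`
-- separates `I` from `A`.
--
-- Adequacy (`Term.converges_iff`) relates the model to reduction. Derivations carry a weight, and
-- `den` records together the typed occurrences of variables and the units of weight. Typing is
-- invariant under outer-head reduction, each step forward loses weight (`Tm.Step.den_forward`), and
-- normal forms are typable; hence a term converges exactly when its interpretation is nonempty. The
-- interpretation is compositional, so inclusion of interpretations implies the observational order.
--
-- Without tests, a context cannot make use of `* = [] :: *`. A converging term is already typable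
-- with free types, where this equation is absent and a type ends after finitely many arrows. Free
-- types are read as reducibility predicates on sets of points of `M∞`, the base type as
-- nonemptiness. If a set is reducible of a free type, so is the set of its delayed points
-- (`Reducible.delay`), because the delay can be placed beyond all the arrows of the free type.
-- Hence `A` is reducible wherever `I` is typable. The fundamental lemma (`compatible_reducible`
-- with `Compatible.plug`) carries this through every context without tests: if `C[I]` converges it
-- has a free type, so `C[A]` has a reducible, hence nonempty, interpretation, and converges by
-- adequacy. The same argument gives `A + I ≤ A`; the converse inequality is an inclusion of
-- interpretations.

/-! ## Induction over simple terms -/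

mutual
theorem Tm.induct {P : Tm → Prop} (var : ∀ n, P (.var n)) (lam : ∀ s, P s → P (.lam s))
    (app : ∀ s L N, P s → (∀ t ∈ L, P t) → (∀ t ∈ N, P t) → P (.app s L N))
    (taubar : ∀ Q, (∀ t ∈ Q, P t) → P (.taubar Q)) : ∀ s, P s
  | .var n => var n
  | .lam s => lam s (Tm.induct var lam app taubar s)
  | .app s L N => app s L N (Tm.induct var lam app taubar s)
      (Tm.induct_list var lam app taubar L) (Tm.induct_list var lam app taubar N)
  | .taubar Q => taubar Q (Tm.induct_list var lam app taubar Q)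
theorem Tm.induct_list {P : Tm → Prop} (var : ∀ n, P (.var n)) (lam : ∀ s, P s → P (.lam s))
    (app : ∀ s L N, P s → (∀ t ∈ L, P t) → (∀ t ∈ N, P t) → P (.app s L N))
    (taubar : ∀ Q, (∀ t ∈ Q, P t) → P (.taubar Q)) : ∀ L : List Tm, ∀ t ∈ L, P t
  | [] => by simp
  | s :: L => by
    intro t ht
    rcases List.mem_cons.1 ht with h | h
    · exact h ▸ Tm.induct var lam app taubar s
    · exact Tm.induct_list var lam app taubar L t h
end

/-! ## Families of resources indexed by a multiset -/

/-- `Bind K v c`: the resource `c` is a sum of resources, one for each element of `v`, as allowed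
by `K`. -/
def Bind {α M : Type*} [AddCommMonoid M] (K : α → M → Prop) (v : Multiset α) (c : M) : Prop :=
  ∃ m, Multiset.Rel K v m ∧ c = m.sum

namespace Bind

variable {α β M : Type*} [AddCommMonoid M] {K : α → M → Prop}

@[simp] theorem zero_iff {c : M} : Bind K 0 c ↔ c = 0 := by
  simp [Bind, Multiset.rel_zero_left]

@[simp] theorem cons_iff {x : α} {v : Multiset α} {c : M} :
    Bind K (x ::ₘ v) c ↔ ∃ a b, c = a + b ∧ K x a ∧ Bind K v b := by
  constructor
  · rintro ⟨m, hm, rfl⟩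
    obtain ⟨a, m', ha, hm', rfl⟩ := Multiset.rel_cons_left.1 hm
    exact ⟨a, m'.sum, by simp, ha, m', hm', rfl⟩
  · rintro ⟨a, b, rfl, ha, m, hm, rfl⟩
    exact ⟨a ::ₘ m, .cons ha hm, by simp⟩

@[simp] theorem singleton_iff {x : α} {c : M} : Bind K {x} c ↔ K x c := by
  rw [← Multiset.cons_zero, cons_iff]
  simp

theorem add_iff {v w : Multiset α} {c : M} :
    Bind K (v + w) c ↔ ∃ a b, c = a + b ∧ Bind K v a ∧ Bind K w b := by
  constructor
  · rintro ⟨m, hm, rfl⟩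
    obtain ⟨m₁, m₂, h₁, h₂, rfl⟩ := Multiset.rel_add_left.1 hm
    exact ⟨m₁.sum, m₂.sum, by simp, ⟨m₁, h₁, rfl⟩, m₂, h₂, rfl⟩
  · rintro ⟨a, b, rfl, ⟨m₁, h₁, rfl⟩, m₂, h₂, rfl⟩
    exact ⟨m₁ + m₂, h₁.add h₂, by simp⟩

theorem map_iff {f : β → α} {v : Multiset β} {c : M} :
    Bind K (v.map f) c ↔ Bind (fun x => K (f x)) v c := by
  simp only [Bind, Multiset.rel_map_left]

theorem eq_iff {f : α → M} {v : Multiset α} {c : M} :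
    Bind (fun x b => b = f x) v c ↔ c = (v.map f).sum := by
  induction v using Multiset.induction generalizing c with
  | empty => simp
  | cons x v ih => simp [ih]

theorem congr {K' : α → M → Prop} {v : Multiset α} {c : M} (h : ∀ x ∈ v, ∀ b, K x b ↔ K' x b) :
    Bind K v c ↔ Bind K' v c := by
  induction v using Multiset.induction generalizing c with
  | empty => simp
  | cons x v ih =>
    simp only [cons_iff]
    have := fun b => ih (c := b) fun y hy => h y (Multiset.mem_cons_of_mem hy)
    simp [this, h x (Multiset.mem_cons_self x v)]

/-- Substitution of resources for resources, under a multiset of copies. -/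
theorem comp {M' : Type*} [AddCommMonoid M'] {J : β → Multiset α → Prop} {K : α → M' → Prop}
    {v : Multiset β} {c : M'} :
    Bind (fun p c => ∃ e, J p e ∧ Bind K e c) v c ↔ ∃ e, Bind J v e ∧ Bind K e c := by
  induction v using Multiset.induction generalizing c with
  | empty => simp
  | cons x v ih =>
    simp only [cons_iff, ih]
    constructor
    · rintro ⟨a, b, rfl, ⟨e, he, ha⟩, e', he', hb⟩
      exact ⟨e + e', ⟨e, e', rfl, he, he'⟩, add_iff.2 ⟨a, b, rfl, ha, hb⟩⟩
    · rintro ⟨_, ⟨e, e', rfl, he, he'⟩, h⟩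
      obtain ⟨a, b, rfl, ha, hb⟩ := add_iff.1 h
      exact ⟨a, b, rfl, ⟨e, he, ha⟩, e', he', hb⟩

/-- Where a given element of the total resource comes from. -/
theorem eq_cons {K : α → Multiset β → Prop} {x : β} {v : Multiset α} {d : Multiset β}
    (h : Bind K v (x ::ₘ d)) :
    ∃ p v' a b, v = p ::ₘ v' ∧ d = a + b ∧ K p (x ::ₘ a) ∧ Bind K v' b := by
  classical
  induction v using Multiset.induction generalizing d with
  | empty => simp at h
  | cons p v ih =>
    obtain ⟨a, b, hab, ha, hb⟩ := cons_iff.1 h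
    have hx : x ∈ a + b := hab ▸ Multiset.mem_cons_self x d
    rcases Multiset.mem_add.1 hx with hx | hx
    · obtain ⟨a', rfl⟩ := Multiset.exists_cons_of_mem hx
      rw [Multiset.cons_add, Multiset.cons_inj_right] at hab
      exact ⟨p, v, a', b, rfl, hab, ha, hb⟩
    · obtain ⟨b', rfl⟩ := Multiset.exists_cons_of_mem hx
      rw [Multiset.add_cons, Multiset.cons_inj_right] at hab
      obtain ⟨q, v', a₂, b₂, rfl, rfl, h₁, h₂⟩ := ih hb
      refine ⟨q, p ::ₘ v', a₂, a + b₂, Multiset.cons_swap _ _ _, ?_, h₁,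
        cons_iff.2 ⟨a, b₂, rfl, ha, h₂⟩⟩
      rw [hab]; abel

end Bind

theorem _root_.Multiset.cons_eq_add {α : Type*} {x : α} {a b c : Multiset α} :
    x ::ₘ a = b + c ↔
      (∃ b', b = x ::ₘ b' ∧ a = b' + c) ∨ ∃ c', c = x ::ₘ c' ∧ a = b + c' := by
  constructor
  · intro h
    have hx : x ∈ b + c := h ▸ Multiset.mem_cons_self x a
    rcases Multiset.mem_add.1 hx with hx | hx
    · obtain ⟨b', rfl⟩ := Multiset.exists_cons_of_mem hx
      rw [Multiset.cons_add, Multiset.cons_inj_right] at h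
      exact .inl ⟨b', rfl, h⟩
    · obtain ⟨c', rfl⟩ := Multiset.exists_cons_of_mem hx
      rw [Multiset.add_cons, Multiset.cons_inj_right] at h
      exact .inr ⟨c', rfl, h⟩
  · rintro (⟨b', rfl, rfl⟩ | ⟨c', rfl, rfl⟩) <;> simp

/-! ## Weighted contexts -/

/-- The elements of weighted contexts: a typed occurrence of a variable, or a unit of weight. -/
inductive Atom (D : Type) : Type
  | tick : Atom D
  | occ : ℕ → D → Atom D

/-- A weighted context: the typed occurrences of free variables in a derivation, and as many units
of weight as the derivation has constructors other than variables. -/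
abbrev Cx (D : Type) : Type := Multiset (Atom D)

variable {D : Type}

/-- Renaming of variables. -/
def Atom.map (f : ℕ → ℕ) : Atom D → Atom D
  | .tick => .tick
  | .occ n p => .occ (f n) p

/-- The type that an element of a context gives to the variable `0`. -/
def Atom.hd : Atom D → Option D
  | .occ 0 p => some p
  | _ => none

/-- The part of an element of a context that does not concern the variable `0`. -/
def Atom.tl : Atom D → Option (Atom D)
  | .tick => some .tick
  | .occ 0 _ => none
  | .occ (n + 1) p => some (.occ n p)

/-- The context in which all variables have been shifted by one. -/
def Cx.up (c : Cx D) : Cx D := c.map (Atom.map Nat.succ)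

/-- The context extended by the types `v` for the new variable `0`. -/
def Cx.ext (v : Multiset D) (c : Cx D) : Cx D := v.map (Atom.occ 0) + c.up

namespace Cx

@[simp] theorem up_zero : up (0 : Cx D) = 0 := rfl

@[simp] theorem up_add (a b : Cx D) : up (a + b) = up a + up b := Multiset.map_add _ _ _

@[simp] theorem up_occ (n : ℕ) (p : D) (a : Cx D) :
    up (Atom.occ n p ::ₘ a) = Atom.occ (n + 1) p ::ₘ up a := Multiset.map_cons _ _ _

@[simp] theorem up_tick (a : Cx D) : up (Atom.tick ::ₘ a) = Atom.tick ::ₘ up a :=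
  Multiset.map_cons _ _ _

@[simp] theorem ext_zero (c : Cx D) : ext 0 c = c.up := by simp [ext]

theorem ext_add (v w : Multiset D) (a b : Cx D) : ext (v + w) (a + b) = ext v a + ext w b := by
  simp only [ext, Multiset.map_add, up_add]; abel

@[simp] theorem ext_cons (p : D) (v : Multiset D) (c : Cx D) :
    ext (p ::ₘ v) c = Atom.occ 0 p ::ₘ ext v c := by simp [ext]

@[simp] theorem ext_occ (v : Multiset D) (n : ℕ) (p : D) (c : Cx D) :
    ext v (Atom.occ n p ::ₘ c) = Atom.occ (n + 1) p ::ₘ ext v c := by simp [ext]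

@[simp] theorem ext_tick (v : Multiset D) (c : Cx D) :
    ext v (Atom.tick ::ₘ c) = Atom.tick ::ₘ ext v c := by simp [ext]

/-- With `filterMap_tl_ext`, this provides left inverses of the extension, hence the unique
splitting of a context into the part of the variable `0` and the rest. -/
theorem filterMap_hd_ext (v : Multiset D) (c : Cx D) : (ext v c).filterMap Atom.hd = v := by
  induction v using Multiset.induction with
  | empty =>
    induction c using Multiset.induction with
    | empty => simp
    | cons x c ih =>
      rw [ext_zero] at ih ⊢
      cases x with
      | tick => rw [up_tick, Multiset.filterMap_cons_none _ _ rfl, ih]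
      | occ n p => rw [up_occ, Multiset.filterMap_cons_none _ _ rfl, ih]
  | cons p v ih => rw [ext_cons, Multiset.filterMap_cons_some Atom.hd _ _ (b := p) rfl, ih]

theorem filterMap_tl_ext (v : Multiset D) (c : Cx D) : (ext v c).filterMap Atom.tl = c := by
  induction v using Multiset.induction with
  | empty =>
    induction c using Multiset.induction with
    | empty => simp
    | cons x c ih =>
      rw [ext_zero] at ih ⊢
      cases x with
      | tick => rw [up_tick, Multiset.filterMap_cons_some Atom.tl _ _ (b := Atom.tick) rfl, ih]
      | occ n p => rw [up_occ, Multiset.filterMap_cons_some Atom.tl _ _ (b := Atom.occ n p) rfl, ih]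
  | cons p v ih => rw [ext_cons, Multiset.filterMap_cons_none _ _ rfl, ih]

@[simp] theorem ext_inj {v w : Multiset D} {a b : Cx D} : ext v a = ext w b ↔ v = w ∧ a = b := by
  refine ⟨fun h => ⟨?_, ?_⟩, fun ⟨h, h'⟩ => h ▸ h' ▸ rfl⟩
  · rw [← filterMap_hd_ext v a, h, filterMap_hd_ext]
  · rw [← filterMap_tl_ext v a, h, filterMap_tl_ext]

theorem exists_ext (c : Cx D) : ∃ v a, c = ext v a := by
  induction c using Multiset.induction with
  | empty => exact ⟨0, 0, by simp⟩
  | cons x c ih =>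
    obtain ⟨v, a, rfl⟩ := ih
    cases x with
    | tick => exact ⟨v, .tick ::ₘ a, by simp⟩
    | occ n p =>
      cases n with
      | zero => exact ⟨p ::ₘ v, a, by simp⟩
      | succ n => exact ⟨v, .occ n p ::ₘ a, by simp⟩

end Cx

/-! ## Weighted typing in a model -/

/-- The structure on types that the typing rules use. -/
structure Model (D : Type) where
  /-- The arrow. -/
  cons : Multiset D → D → D
  /-- Arrow types are decomposed in only one way. -/
  cons_inj : ∀ {v w p q}, cons v p = cons w q → v = w ∧ p = q
  /-- The types of tests. -/
  isStar : D → Prop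
  /-- A type of tests. -/
  star : D
  isStar_star : isStar star
  isStar_cons : ∀ {p}, isStar p → isStar (cons 0 p)

mutual
/-- Weighted typing of simple terms. -/
def den (𝓜 : Model D) : Tm → Cx D → D → Prop
  | .var n => fun c p => c = {.occ n p}
  | .lam s => fun c p => ∃ v q a, p = 𝓜.cons v q ∧ c = .tick ::ₘ a ∧ den 𝓜 s (.ext v a) q
  | .app s L N => fun c p => ∃ a b d u v, c = .tick ::ₘ (a + b + d) ∧
      den 𝓜 s a (𝓜.cons (u + v) p) ∧ denLin 𝓜 L b u ∧ Bind (fun q e => denSum 𝓜 N e q) v d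
  | .taubar Q => fun c p => 𝓜.isStar p ∧ ∃ a u, c = .tick ::ₘ a ∧ denLin 𝓜 Q a u ∧
      ∀ q ∈ u, 𝓜.isStar q
/-- Weighted typing of lists of simple terms, each used once. -/
def denLin (𝓜 : Model D) : List Tm → Cx D → Multiset D → Prop
  | [] => fun c u => c = 0 ∧ u = 0
  | t :: L => fun c u => ∃ a b p w, c = a + b ∧ u = p ::ₘ w ∧ den 𝓜 t a p ∧ denLin 𝓜 L b w
/-- Weighted typing of sums of simple terms. -/
def denSum (𝓜 : Model D) : List Tm → Cx D → D → Prop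
  | [] => fun _ _ => False
  | t :: N => fun c p => den 𝓜 t c p ∨ denSum 𝓜 N c p
end

theorem denSum_iff {𝓜 : Model D} {N : List Tm} {c : Cx D} {p : D} :
    denSum 𝓜 N c p ↔ ∃ s ∈ N, den 𝓜 s c p := by
  induction N with
  | nil => simp [denSum]
  | cons t N ih => simp [denSum, ih]

theorem denLin_append {𝓜 : Model D} {L L' : List Tm} {c : Cx D} {u : Multiset D} :
    denLin 𝓜 (L ++ L') c u ↔
      ∃ a b v w, c = a + b ∧ u = v + w ∧ denLin 𝓜 L a v ∧ denLin 𝓜 L' b w := by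
  induction L generalizing c u with
  | nil => simp [denLin]
  | cons t L ih =>
    simp only [List.cons_append, denLin, ih]
    constructor
    · rintro ⟨a, _, p, _, rfl, rfl, h, a', b', v, w, rfl, rfl, h₁, h₂⟩
      exact ⟨a + a', b', p ::ₘ v, w, by abel, by simp, ⟨a, a', p, v, rfl, rfl, h, h₁⟩, h₂⟩
    · rintro ⟨_, b, _, w, rfl, rfl, ⟨a, a', p, v, rfl, rfl, h, h₁⟩, h₂⟩
      exact ⟨a, a' + b, p, v + w, by abel, by simp, h, a', b, v, w, rfl, rfl, h₁, h₂⟩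

/-! ## Renaming -/

theorem Atom.map_ext (f : ℕ → ℕ) (v : Multiset D) (c : Cx D) :
    (Cx.ext v c).map (Atom.map fun n => Nat.casesOn n 0 fun m => f m + 1) =
      Cx.ext v (c.map (Atom.map f)) := by
  induction v using Multiset.induction with
  | empty =>
    simp only [Cx.ext_zero, Cx.up, Multiset.map_map]
    refine Multiset.map_congr rfl fun x _ => ?_
    cases x <;> rfl
  | cons p v ih => rw [Cx.ext_cons, Cx.ext_cons, Multiset.map_cons, ih]; rfl

theorem denLin_renameList {𝓜 : Model D} {f : ℕ → ℕ} {L : List Tm}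
    (h : ∀ t ∈ L, ∀ c p, den 𝓜 (t.rename f) c p ↔ ∃ e, den 𝓜 t e p ∧ c = e.map (Atom.map f))
    {c : Cx D} {u : Multiset D} :
    denLin 𝓜 (Tm.renameList f L) c u ↔ ∃ e, denLin 𝓜 L e u ∧ c = e.map (Atom.map f) := by
  induction L generalizing c u with
  | nil => simp [Tm.renameList, denLin]; tauto
  | cons t L ih =>
    have ih := fun c u => ih (fun t ht => h t (List.mem_cons_of_mem _ ht)) (c := c) (u := u)
    simp only [Tm.renameList, denLin, ih, h t List.mem_cons_self]
    constructor
    · rintro ⟨_, _, p, w, rfl, rfl, ⟨e, he, rfl⟩, e', he', rfl⟩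
      exact ⟨e + e', ⟨e, e', p, w, rfl, rfl, he, he'⟩, by simp⟩
    · rintro ⟨_, ⟨e, e', p, w, rfl, rfl, he, he'⟩, rfl⟩
      exact ⟨_, _, p, w, by simp, rfl, ⟨e, he, rfl⟩, e', he', rfl⟩

theorem mem_renameList {f : ℕ → ℕ} {L : List Tm} {s : Tm} :
    s ∈ Tm.renameList f L ↔ ∃ t ∈ L, t.rename f = s := by
  induction L with
  | nil => simp [Tm.renameList]
  | cons t L ih => simp [Tm.renameList, ih, eq_comm]

theorem bind_map_iff {α : Type*} {J : α → Cx D → Prop} {g : Atom D → Atom D} {v : Multiset α}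
    {c : Cx D} : Bind (fun p c => ∃ e, J p e ∧ c = e.map g) v c ↔
      ∃ e, Bind J v e ∧ c = e.map g := by
  -- A map is the deterministic case of `Bind`, so that the claim becomes an instance of
  -- `Bind.comp`.
  have key (e c : Cx D) : c = e.map g ↔ Bind (fun x b => b = ({g x} : Cx D)) e c := by
    rw [Bind.eq_iff]
    have h := Multiset.sum_map_singleton (e.map g)
    rw [Multiset.map_map] at h
    exact Eq.congr_right h.symm
  simp only [key]
  exact Bind.comp

theorem den_rename {𝓜 : Model D} (s : Tm) : ∀ (f : ℕ → ℕ) (c : Cx D) (p : D),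
    den 𝓜 (s.rename f) c p ↔ ∃ e, den 𝓜 s e p ∧ c = e.map (Atom.map f) := by
  induction s using Tm.induct with
  | var n => intro f c p; simp [Tm.rename, den, Atom.map]
  | lam s ih =>
    intro f c p
    simp only [Tm.rename, den, ih]
    constructor
    · rintro ⟨v, q, a, rfl, rfl, e, he, h⟩
      obtain ⟨w, e, rfl⟩ := e.exists_ext
      rw [Atom.map_ext, Cx.ext_inj] at h
      obtain ⟨rfl, rfl⟩ := h
      exact ⟨.tick ::ₘ e, ⟨v, q, e, rfl, rfl, he⟩, by simp [Atom.map]⟩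
    · rintro ⟨_, ⟨v, q, e, rfl, rfl, he⟩, rfl⟩
      exact ⟨v, q, e.map (Atom.map f), rfl, by simp [Atom.map], _, he, by rw [Atom.map_ext]⟩
  | app s L N ihs ihL ihN =>
    intro f c p
    have hN (q : D) (e : Cx D) : denSum 𝓜 (Tm.renameList f N) e q ↔
        ∃ e', denSum 𝓜 N e' q ∧ e = e'.map (Atom.map f) := by
      simp only [denSum_iff, mem_renameList]
      constructor
      · rintro ⟨_, ⟨t, ht, rfl⟩, h⟩
        obtain ⟨e', h', rfl⟩ := (ihN t ht f _ _).1 h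
        exact ⟨e', ⟨t, ht, h'⟩, rfl⟩
      · rintro ⟨e', ⟨t, ht, h⟩, rfl⟩
        exact ⟨_, ⟨t, ht, rfl⟩, (ihN t ht f _ _).2 ⟨e', h, rfl⟩⟩
    simp only [Tm.rename, den, ihs, denLin_renameList fun t ht => ihL t ht f, hN, bind_map_iff]
    constructor
    · rintro ⟨_, _, _, u, v, rfl, ⟨a, ha, rfl⟩, ⟨b, hb, rfl⟩, d, hd, rfl⟩
      exact ⟨_, ⟨a, b, d, u, v, rfl, ha, hb, hd⟩, by simp [Atom.map]⟩
    · rintro ⟨_, ⟨a, b, d, u, v, rfl, ha, hb, hd⟩, rfl⟩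
      exact ⟨_, _, _, u, v, by simp [Atom.map], ⟨a, ha, rfl⟩, ⟨b, hb, rfl⟩, d, hd, rfl⟩
  | taubar Q ih =>
    intro f c p
    simp only [Tm.rename, den, denLin_renameList fun t ht => ih t ht f]
    constructor
    · rintro ⟨hp, _, u, rfl, ⟨e, he, rfl⟩, hu⟩
      exact ⟨_, ⟨hp, e, u, rfl, he, hu⟩, by simp [Atom.map]⟩
    · rintro ⟨_, ⟨hp, e, u, rfl, he, hu⟩, rfl⟩
      exact ⟨hp, _, u, by simp [Atom.map], ⟨e, he, rfl⟩, hu⟩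

theorem den_shift {𝓜 : Model D} {s : Tm} {c : Cx D} {p : D} :
    den 𝓜 s.shift c p ↔ ∃ e, den 𝓜 s e p ∧ c = e.up :=
  den_rename s Nat.succ c p

variable {𝓜 : Model D}

/-! ## Linear substitution -/

theorem Cx.occ_cons_eq_tick_cons {x : ℕ} {q : D} {a b : Cx D}
    (h : Atom.occ x q ::ₘ a = .tick ::ₘ b) : ∃ c, a = .tick ::ₘ c ∧ b = .occ x q ::ₘ c := by
  rcases Multiset.cons_eq_cons.1 h with ⟨h, _⟩ | ⟨_, c, h₁, h₂⟩
  · cases h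
  · exact ⟨c, h₁, h₂⟩

theorem mem_lsubstSum {x : ℕ} {t u : Tm} {N : List Tm} :
    u ∈ Tm.lsubstSum x t N ↔ ∃ s ∈ N, u ∈ Tm.lsubst x t s := by
  induction N with
  | nil => simp [Tm.lsubstSum]
  | cons s N ih => simp [Tm.lsubstSum, ih]

theorem denLin_lsubstOne {x : ℕ} {t : Tm} {L : List Tm}
    (h : ∀ s ∈ L, ∀ c p, (∃ s' ∈ Tm.lsubst x t s, den 𝓜 s' c p) ↔
      ∃ a q b, den 𝓜 s (.occ x q ::ₘ a) p ∧ den 𝓜 t b q ∧ c = a + b)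
    {c : Cx D} {u : Multiset D} :
    (∃ L' ∈ Tm.lsubstOne x t L, denLin 𝓜 L' c u) ↔
      ∃ a q b, denLin 𝓜 L (.occ x q ::ₘ a) u ∧ den 𝓜 t b q ∧ c = a + b := by
  induction L generalizing c u with
  | nil => simp [Tm.lsubstOne, denLin]
  | cons s L ih =>
    have ih := fun c u => ih (fun t ht => h t (List.mem_cons_of_mem _ ht)) (c := c) (u := u)
    have hs := h s List.mem_cons_self
    simp only [Tm.lsubstOne, List.mem_append, List.mem_map]
    constructor
    · rintro ⟨_, ⟨s', hs', rfl⟩ | ⟨L', hL', rfl⟩, a, b, p, w, rfl, rfl, h₁, h₂⟩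
      · obtain ⟨a, q, e, ha, he, rfl⟩ := (hs _ _).1 ⟨s', hs', h₁⟩
        exact ⟨a + b, q, e, ⟨_, b, p, w, by simp, rfl, ha, h₂⟩, he, by abel⟩
      · obtain ⟨b, q, e, hb, he, rfl⟩ := (ih _ _).1 ⟨L', hL', h₂⟩
        exact ⟨a + b, q, e, ⟨a, _, p, w, by simp, rfl, h₁, hb⟩, he, by abel⟩
    · rintro ⟨_, q, e, ⟨a, b, p, w, hab, rfl, h₁, h₂⟩, he, rfl⟩
      rcases Multiset.cons_eq_add.1 hab with ⟨a, rfl, rfl⟩ | ⟨b, rfl, rfl⟩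
      · obtain ⟨s', hs', h₁⟩ := (hs _ _).2 ⟨a, q, e, h₁, he, rfl⟩
        exact ⟨_, .inl ⟨s', hs', rfl⟩, _, b, p, w, by abel, rfl, h₁, h₂⟩
      · obtain ⟨L', hL', h₂⟩ := (ih _ _).2 ⟨b, q, e, h₂, he, rfl⟩
        exact ⟨_, .inr ⟨L', hL', rfl⟩, a, _, p, w, by abel, rfl, h₁, h₂⟩

/-- Linear substitution trades one typed occurrence of `x` for a derivation of `t` at the same type.
The sum over all linear occurrences matches the choice of the place where that occurrence sits in
the derivation. -/
theorem den_lsubst (s : Tm) : ∀ (x : ℕ) (t : Tm) (c : Cx D) (p : D),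
    (∃ s' ∈ Tm.lsubst x t s, den 𝓜 s' c p) ↔
      ∃ a q b, den 𝓜 s (.occ x q ::ₘ a) p ∧ den 𝓜 t b q ∧ c = a + b := by
  induction s using Tm.induct with
  | var n =>
    intro x t c p
    by_cases hn : n = x
    · subst hn
      simp only [Tm.lsubst, if_true, List.mem_singleton, den]
      constructor
      · rintro ⟨_, rfl, h⟩
        exact ⟨0, p, c, rfl, h, by simp⟩
      · rintro ⟨a, q, b, ha, h, rfl⟩
        rw [← Multiset.cons_zero, Multiset.cons_eq_cons] at ha
        rcases ha with ⟨h', rfl⟩ | ⟨_, _, _, h'⟩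
        · cases h'
          exact ⟨t, rfl, by simpa using h⟩
        · simp at h'
    · simp only [Tm.lsubst, if_neg hn, den]
      constructor
      · rintro ⟨_, h, _⟩
        cases h
      · rintro ⟨a, q, b, ha, h, rfl⟩
        rw [← Multiset.cons_zero, Multiset.cons_eq_cons] at ha
        rcases ha with ⟨h', rfl⟩ | ⟨_, _, _, h'⟩
        · cases h'
          exact absurd rfl hn
        · simp at h'
  | lam s ih =>
    intro x t c p
    simp only [Tm.lsubst, List.mem_map]
    constructor
    · rintro ⟨_, ⟨s', hs', rfl⟩, v, q, a, rfl, rfl, h⟩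
      obtain ⟨a', r, b, h₁, h₂, h₃⟩ := (ih _ _ _ _).1 ⟨s', hs', h⟩
      obtain ⟨b, hb, rfl⟩ := den_shift.1 h₂
      obtain ⟨w, a', rfl⟩ := Cx.exists_ext a'
      rw [← Cx.ext_zero, ← Cx.ext_add, Cx.ext_inj] at h₃
      obtain ⟨rfl, rfl⟩ := h₃
      exact ⟨.tick ::ₘ a', r, b, ⟨_, q, .occ x r ::ₘ a', rfl, Multiset.cons_swap _ _ _,
        by simpa using h₁⟩, hb, by simp⟩
    · rintro ⟨_, r, b, ⟨v, q, a, rfl, ha, h⟩, hb, rfl⟩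
      obtain ⟨a, rfl, rfl⟩ := Cx.occ_cons_eq_tick_cons ha
      obtain ⟨s', hs', h⟩ := (ih _ _ _ _).2
        ⟨Cx.ext v a, r, (Cx.up b), by simpa using h, den_shift.2 ⟨b, hb, rfl⟩, rfl⟩
      refine ⟨_, ⟨s', hs', rfl⟩, v, q, a + b, rfl, by simp, ?_⟩
      rwa [← Cx.ext_zero, ← Cx.ext_add, add_zero] at h
  | app s L N ihs ihL ihN =>
    intro x t c p
    have hL (c u) := denLin_lsubstOne (fun s hs => ihL s hs x t) (c := c) (u := u)
    simp only [Tm.lsubst, List.mem_append, List.mem_map]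
    constructor
    · rintro ⟨_, (⟨s', hs', rfl⟩ | ⟨L', hL', rfl⟩) | ⟨r, hr, rfl⟩, h⟩
      · obtain ⟨a, b, d, u, v, rfl, h₁, h₂, h₃⟩ := h
        obtain ⟨a, q, e, ha, he, rfl⟩ := (ihs _ _ _ _).1 ⟨s', hs', h₁⟩
        exact ⟨.tick ::ₘ (a + b + d), q, e, ⟨_, b, d, u, v, by simp [Multiset.cons_swap], ha,
          h₂, h₃⟩, he, by simp only [Multiset.cons_add]; congr 1; abel⟩
      · obtain ⟨a, b, d, u, v, rfl, h₁, h₂, h₃⟩ := h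
        obtain ⟨b, q, e, hb, he, rfl⟩ := (hL _ _).1 ⟨L', hL', h₂⟩
        exact ⟨.tick ::ₘ (a + b + d), q, e, ⟨a, _, d, u, v, by simp [Multiset.cons_swap], h₁,
          hb, h₃⟩, he, by simp only [Multiset.cons_add]; congr 1; abel⟩
      · obtain ⟨a, _, d, _, v, rfl, h₁, ⟨g, b, r', u, rfl, rfl, h₀, h₂⟩, h₃⟩ := h
        obtain ⟨r₀, hr₀, hr⟩ := mem_lsubstSum.1 hr
        obtain ⟨g, q, e, hg, he, rfl⟩ := (ihN r₀ hr₀ _ _ _ _).1 ⟨r, hr, h₀⟩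
        -- The linear copy `r` came from under the bang. Its type `r'` moves back from the linear
        -- types to the banged ones, which leaves the total `u + v` unchanged.
        refine ⟨.tick ::ₘ (a + b + (g + d)), q, e, ⟨a, b, .occ x q ::ₘ g + d, u, r' ::ₘ v, ?_, ?_,
          h₂, Bind.cons_iff.2 ⟨_, d, rfl, denSum_iff.2 ⟨r₀, hr₀, hg⟩, h₃⟩⟩, he, ?_⟩
        · simp [Multiset.cons_swap]
        · simpa using h₁
        · simp only [Multiset.cons_add]; congr 1; abel
    · rintro ⟨_, q, e, ⟨a, b, d, u, v, habd, h₁, h₂, h₃⟩, he, rfl⟩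
      obtain ⟨c, rfl, habd'⟩ := Cx.occ_cons_eq_tick_cons habd
      rcases Multiset.cons_eq_add.1 habd'.symm with ⟨ab, hab, rfl⟩ | ⟨d, rfl, rfl⟩
      · rcases Multiset.cons_eq_add.1 hab.symm with ⟨a, rfl, rfl⟩ | ⟨b, rfl, rfl⟩
        · obtain ⟨s', hs', h₁⟩ := (ihs _ _ _ _).2 ⟨a, q, e, h₁, he, rfl⟩
          exact ⟨_, .inl (.inl ⟨s', hs', rfl⟩), _, b, d, u, v,
            by simp only [Multiset.cons_add]; congr 1; abel, h₁, h₂, h₃⟩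
        · obtain ⟨L', hL', h₂⟩ := (hL _ _).2 ⟨b, q, e, h₂, he, rfl⟩
          exact ⟨_, .inl (.inr ⟨L', hL', rfl⟩), a, _, d, u, v,
            by simp only [Multiset.cons_add]; congr 1; abel, h₁, h₂, h₃⟩
      · obtain ⟨r', v, g, d, rfl, rfl, h₀, h₃⟩ := Bind.eq_cons h₃
        obtain ⟨r₀, hr₀, h₀⟩ := denSum_iff.1 h₀
        obtain ⟨r, hr, h₀⟩ := (ihN r₀ hr₀ _ _ _ _).2 ⟨g, q, e, h₀, he, rfl⟩
        refine ⟨_, .inr ⟨r, mem_lsubstSum.2 ⟨r₀, hr₀, hr⟩, rfl⟩, a, (g + e) + b, d, r' ::ₘ u, v,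
          ?_, by simpa using h₁, ⟨_, b, r', u, rfl, rfl, h₀, h₂⟩, h₃⟩
        simp only [Multiset.cons_add]; congr 1; abel
  | taubar Q ih =>
    intro x t c p
    have hQ (c u) := denLin_lsubstOne (fun s hs => ih s hs x t) (c := c) (u := u)
    simp only [Tm.lsubst, List.mem_map]
    constructor
    · rintro ⟨_, ⟨Q', hQ', rfl⟩, hp, a, u, rfl, h, hu⟩
      obtain ⟨a, q, e, ha, he, rfl⟩ := (hQ _ _).1 ⟨Q', hQ', h⟩
      exact ⟨.tick ::ₘ a, q, e, ⟨hp, _, u, Multiset.cons_swap _ _ _, ha, hu⟩, he, by simp⟩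
    · rintro ⟨_, q, e, ⟨hp, a, u, ha, h, hu⟩, he, rfl⟩
      obtain ⟨a, rfl, rfl⟩ := Cx.occ_cons_eq_tick_cons ha
      obtain ⟨Q', hQ', h⟩ := (hQ _ _).2 ⟨a, q, e, h, he, rfl⟩
      exact ⟨_, ⟨Q', hQ', rfl⟩, hp, _, u, by simp, h, hu⟩

/-! ## Substitution -/

/-- What the substitution `σ` may put in the place of an element of a context. -/
def substAtom (𝓜 : Model D) (σ : ℕ → Term) : Atom D → Cx D → Prop
  | .tick => fun b => b = {.tick}
  | .occ n p => fun b => ∃ s ∈ σ n, den 𝓜 s b p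

theorem bind_up {σ : ℕ → Term} {e c : Cx D} :
    Bind (substAtom 𝓜 (liftSubst σ)) (Cx.up e) c ↔
      ∃ a, c = (Cx.up a) ∧ Bind (substAtom 𝓜 σ) e a := by
  induction e using Multiset.induction generalizing c with
  | empty => simp
  | cons x e ih =>
    have hx (b : Cx D) : substAtom 𝓜 (liftSubst σ) (x.map Nat.succ) b ↔
        ∃ a, b = (Cx.up a) ∧ substAtom 𝓜 σ x a := by
      cases x with
      | tick => simp [Atom.map, substAtom, Cx.up]
      | occ n p =>
        simp only [Atom.map, substAtom, liftSubst, List.mem_map]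
        constructor
        · rintro ⟨_, ⟨s, hs, rfl⟩, h⟩
          obtain ⟨a, ha, rfl⟩ := den_shift.1 h
          exact ⟨a, rfl, s, hs, ha⟩
        · rintro ⟨a, rfl, s, hs, ha⟩
          exact ⟨_, ⟨s, hs, rfl⟩, den_shift.2 ⟨a, ha, rfl⟩⟩
    rw [Cx.up, Multiset.map_cons, Bind.cons_iff]
    change (∃ a b, c = a + b ∧ _ ∧ Bind _ (Cx.up e) b) ↔ _
    simp only [ih, hx, Bind.cons_iff]
    constructor
    · rintro ⟨_, _, rfl, ⟨a, rfl, ha⟩, b, rfl, hb⟩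
      exact ⟨a + b, by simp, a, b, rfl, ha, hb⟩
    · rintro ⟨_, rfl, a, b, rfl, ha, hb⟩
      exact ⟨_, _, by simp, ⟨a, rfl, ha⟩, b, rfl, hb⟩

theorem bind_ext {σ : ℕ → Term} {v : Multiset D} {e c : Cx D} :
    Bind (substAtom 𝓜 (liftSubst σ)) (Cx.ext v e) c ↔
      ∃ a, c = Cx.ext v a ∧ Bind (substAtom 𝓜 σ) e a := by
  induction v using Multiset.induction generalizing c with
  | empty => simp [bind_up]
  | cons p v ih =>
    simp only [Cx.ext_cons, Bind.cons_iff, ih]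
    constructor
    · rintro ⟨_, _, rfl, h, a, rfl, ha⟩
      obtain ⟨s, hs, h⟩ := h
      rw [liftSubst, List.mem_singleton] at hs
      subst hs
      rw [den] at h
      subst h
      exact ⟨a, by simp, ha⟩
    · rintro ⟨a, rfl, ha⟩
      exact ⟨{Atom.occ 0 p}, _, by simp, ⟨.var 0, by simp [liftSubst], by rw [den]⟩, a, rfl, ha⟩

theorem mem_substSum {σ : ℕ → Term} {N : List Tm} {u : Tm} :
    u ∈ Tm.substSum σ N ↔ ∃ s ∈ N, u ∈ Tm.subst σ s := by
  induction N with
  | nil => simp [Tm.substSum]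
  | cons s N ih => simp [Tm.substSum, ih]

theorem exists_mem_sections_cons {α : Type*} {l : List α} {L : List (List α)}
    {P : List α → Prop} : (∃ m ∈ (l :: L).sections, P m) ↔
      ∃ x ∈ l, ∃ m ∈ L.sections, P (x :: m) := by
  simp only [List.mem_sections]
  constructor
  · rintro ⟨_, _ | ⟨hx, hm⟩, h⟩
    exact ⟨_, hx, _, hm, h⟩
  · rintro ⟨x, hx, m, hm, h⟩
    exact ⟨_, .cons hx hm, h⟩

theorem denLin_substEach {σ : ℕ → Term} {L : List Tm}
    (h : ∀ s ∈ L, ∀ c p, (∃ s' ∈ Tm.subst σ s, den 𝓜 s' c p) ↔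
      ∃ e, den 𝓜 s e p ∧ Bind (substAtom 𝓜 σ) e c)
    {c : Cx D} {u : Multiset D} :
    (∃ L' ∈ (Tm.substEach σ L).sections, denLin 𝓜 L' c u) ↔
      ∃ e, denLin 𝓜 L e u ∧ Bind (substAtom 𝓜 σ) e c := by
  induction L generalizing c u with
  | nil =>
    simp only [Tm.substEach, denLin, List.sections, List.mem_singleton]
    constructor
    · rintro ⟨_, rfl, rfl, rfl⟩
      exact ⟨0, ⟨rfl, rfl⟩, by simp⟩
    · rintro ⟨_, ⟨rfl, rfl⟩, h⟩
      exact ⟨_, rfl, Bind.zero_iff.1 h, rfl⟩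
  | cons s L ih =>
    have ih := fun c u => ih (fun t ht => h t (List.mem_cons_of_mem _ ht)) (c := c) (u := u)
    have hs := h s List.mem_cons_self
    rw [Tm.substEach, exists_mem_sections_cons]
    simp only [denLin]
    constructor
    · rintro ⟨s', hs', L', hL', a, b, p, w, rfl, rfl, h₁, h₂⟩
      obtain ⟨e, he, h₁⟩ := (hs _ _).1 ⟨s', hs', h₁⟩
      obtain ⟨e', he', h₂⟩ := (ih _ _).1 ⟨L', hL', h₂⟩
      exact ⟨_, ⟨e, e', p, w, rfl, rfl, he, he'⟩, Bind.add_iff.2 ⟨a, b, rfl, h₁, h₂⟩⟩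
    · rintro ⟨_, ⟨e, e', p, w, rfl, rfl, he, he'⟩, h⟩
      obtain ⟨a, b, rfl, h₁, h₂⟩ := Bind.add_iff.1 h
      obtain ⟨s', hs', h₁⟩ := (hs _ _).2 ⟨e, he, h₁⟩
      obtain ⟨L', hL', h₂⟩ := (ih _ _).2 ⟨e', he', h₂⟩
      exact ⟨s', hs', L', hL', a, b, p, w, rfl, rfl, h₁, h₂⟩

theorem bind_tick_cons {σ : ℕ → Term} {e c : Cx D} :
    Bind (substAtom 𝓜 σ) (.tick ::ₘ e) c ↔ ∃ a, c = .tick ::ₘ a ∧ Bind (substAtom 𝓜 σ) e a := by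
  simp only [Bind.cons_iff, substAtom]
  constructor
  · rintro ⟨_, a, rfl, rfl, h⟩
    exact ⟨a, by simp, h⟩
  · rintro ⟨a, rfl, h⟩
    exact ⟨_, a, by simp, rfl, h⟩

/-- Each typed occurrence in a derivation of `s` receives its own derivation of a summand of the
substituted term. Distributing sums out of linear positions is harmless, because a linear component
is typed once and so uses a single summand. -/
theorem den_subst (s : Tm) : ∀ (σ : ℕ → Term) (c : Cx D) (p : D),
    (∃ s' ∈ Tm.subst σ s, den 𝓜 s' c p) ↔
      ∃ e, den 𝓜 s e p ∧ Bind (substAtom 𝓜 σ) e c := by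
  induction s using Tm.induct with
  | var n => intro σ c p; simp [Tm.subst, den, substAtom]
  | lam s ih =>
    intro σ c p
    simp only [Tm.subst, Term.lam, List.mem_map]
    constructor
    · rintro ⟨_, ⟨s', hs', rfl⟩, v, q, a, rfl, rfl, h⟩
      obtain ⟨e, he, h⟩ := (ih _ _ _).1 ⟨s', hs', h⟩
      obtain ⟨w, e, rfl⟩ := Cx.exists_ext e
      obtain ⟨a', h', h⟩ := bind_ext.1 h
      obtain ⟨rfl, rfl⟩ := Cx.ext_inj.1 h'
      exact ⟨_, ⟨v, q, e, rfl, rfl, he⟩, bind_tick_cons.2 ⟨a, rfl, h⟩⟩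
    · rintro ⟨_, ⟨v, q, e, rfl, rfl, he⟩, h⟩
      obtain ⟨a, rfl, h'⟩ := bind_tick_cons.1 h
      obtain ⟨s', hs', h⟩ := (ih _ _ _).2 ⟨_, he, bind_ext.2 ⟨a, rfl, h'⟩⟩
      exact ⟨_, ⟨s', hs', rfl⟩, v, q, a, rfl, rfl, h⟩
  | app s L N ihs ihL ihN =>
    intro σ c p
    have hL (c u) := denLin_substEach (fun s hs => ihL s hs σ) (c := c) (u := u)
    have hN (v d) : Bind (fun q e => denSum 𝓜 (Tm.substSum σ N) e q) v d ↔
        ∃ e, Bind (fun q e => denSum 𝓜 N e q) v e ∧ Bind (substAtom 𝓜 σ) e d := by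
      rw [← Bind.comp]
      refine Bind.congr fun q _ b => ?_
      simp only [denSum_iff, mem_substSum]
      constructor
      · rintro ⟨s', ⟨s, hs, hs'⟩, h⟩
        obtain ⟨e, he, h⟩ := (ihN s hs _ _ _).1 ⟨s', hs', h⟩
        exact ⟨e, ⟨s, hs, he⟩, h⟩
      · rintro ⟨e, ⟨s, hs, he⟩, h⟩
        obtain ⟨s', hs', h⟩ := (ihN s hs _ _ _).2 ⟨e, he, h⟩
        exact ⟨s', ⟨s, hs, hs'⟩, h⟩
    simp only [Tm.subst, Term.app, Bag.mk, List.mem_flatMap, List.mem_map]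
    constructor
    · rintro ⟨_, ⟨s', hs', _, ⟨L', hL', rfl⟩, rfl⟩, a, b, d, u, v, rfl, h₁, h₂, h₃⟩
      obtain ⟨e₁, he₁, h₁⟩ := (ihs _ _ _).1 ⟨s', hs', h₁⟩
      obtain ⟨e₂, he₂, h₂⟩ := (hL _ _).1 ⟨L', hL', h₂⟩
      obtain ⟨e₃, he₃, h₃⟩ := (hN _ _).1 h₃
      exact ⟨_, ⟨e₁, e₂, e₃, u, v, rfl, he₁, he₂, he₃⟩, bind_tick_cons.2 ⟨_, rfl,
        Bind.add_iff.2 ⟨_, d, rfl, Bind.add_iff.2 ⟨a, b, rfl, h₁, h₂⟩, h₃⟩⟩⟩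
    · rintro ⟨_, ⟨e₁, e₂, e₃, u, v, rfl, he₁, he₂, he₃⟩, h⟩
      obtain ⟨_, rfl, h'⟩ := bind_tick_cons.1 h
      obtain ⟨_, d, rfl, h'', h₃⟩ := Bind.add_iff.1 h'
      obtain ⟨a, b, rfl, h₁, h₂⟩ := Bind.add_iff.1 h''
      obtain ⟨s', hs', h₁⟩ := (ihs _ _ _).2 ⟨e₁, he₁, h₁⟩
      obtain ⟨L', hL', h₂⟩ := (hL _ _).2 ⟨e₂, he₂, h₂⟩
      exact ⟨_, ⟨s', hs', _, ⟨L', hL', rfl⟩, rfl⟩, a, b, d, u, v, rfl, h₁, h₂,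
        (hN _ _).2 ⟨e₃, he₃, h₃⟩⟩
  | taubar Q ih =>
    intro σ c p
    have hQ (c u) := denLin_substEach (fun s hs => ih s hs σ) (c := c) (u := u)
    simp only [Tm.subst, List.mem_map]
    constructor
    · rintro ⟨_, ⟨Q', hQ', rfl⟩, hp, a, u, rfl, h, hu⟩
      obtain ⟨e, he, h⟩ := (hQ _ _).1 ⟨Q', hQ', h⟩
      exact ⟨_, ⟨hp, e, u, rfl, he, hu⟩, bind_tick_cons.2 ⟨a, rfl, h⟩⟩
    · rintro ⟨_, ⟨hp, e, u, rfl, he, hu⟩, h⟩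
      obtain ⟨a, rfl, h'⟩ := bind_tick_cons.1 h
      obtain ⟨Q', hQ', h⟩ := (hQ _ _).2 ⟨e, he, h'⟩
      exact ⟨_, ⟨Q', hQ', rfl⟩, hp, a, u, rfl, h, hu⟩

theorem bind_single_up {N : Term} {e c : Cx D} :
    Bind (substAtom 𝓜 (single N)) (Cx.up e) c ↔ c = e := by
  induction e using Multiset.induction generalizing c with
  | empty => simp
  | cons x e ih =>
    have hx (b : Cx D) : substAtom 𝓜 (single N) (x.map Nat.succ) b ↔ b = {x} := by
      cases x with
      | tick => simp [Atom.map, substAtom]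
      | occ n p => simp [Atom.map, substAtom, single, den]
    rw [Cx.up, Multiset.map_cons, Bind.cons_iff]
    change (∃ a b, c = a + b ∧ _ ∧ Bind _ (Cx.up e) b) ↔ _
    simp [ih, hx]

theorem bind_single_ext {N : Term} {v : Multiset D} {e c : Cx D} :
    Bind (substAtom 𝓜 (single N)) (Cx.ext v e) c ↔
      ∃ d, c = e + d ∧ Bind (fun q b => denSum 𝓜 N b q) v d := by
  rw [Cx.ext, Bind.add_iff]
  simp only [Bind.map_iff, bind_single_up, substAtom, single, denSum_iff]
  constructor
  · rintro ⟨d, _, rfl, h, rfl⟩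
    exact ⟨d, add_comm _ _, h⟩
  · rintro ⟨d, rfl, h⟩
    exact ⟨d, e, add_comm _ _, h, rfl⟩

/-- The multiset `w` collects the types of the occurrences of the variable `0` that the linear
arguments consume; `a` may still contain further occurrences, left for the argument under the bang.
-/
theorem den_foldl_lsubst {L : List Tm} : ∀ {S : Term} {c : Cx D} {p : D},
    (∃ s' ∈ L.foldl (fun (S : Term) t => S.flatMap (Tm.lsubst 0 t.shift)) S, den 𝓜 s' c p) ↔
      ∃ w a b, (∃ s ∈ S, den 𝓜 s (w.map (Atom.occ 0) + a) p) ∧ denLin 𝓜 L b w ∧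
        c = a + (Cx.up b) := by
  induction L with
  | nil =>
    intro S c p
    simp only [List.foldl_nil, denLin]
    constructor
    · rintro ⟨s, hs, h⟩
      exact ⟨0, c, 0, ⟨s, hs, by simpa using h⟩, ⟨rfl, rfl⟩, by simp⟩
    · rintro ⟨_, a, _, ⟨s, hs, h⟩, ⟨rfl, rfl⟩, rfl⟩
      exact ⟨s, hs, by simpa using h⟩
  | cons t L ih =>
    intro S c p
    rw [List.foldl_cons, ih]
    simp only [denLin, List.mem_flatMap]
    constructor
    · rintro ⟨w, a, b, ⟨s', ⟨s, hs, hs'⟩, h⟩, hb, rfl⟩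
      obtain ⟨a', q, e, h₁, h₂, h₃⟩ := (den_lsubst _ _ _ _ _).1 ⟨s', hs', h⟩
      obtain ⟨e, he, rfl⟩ := den_shift.1 h₂
      -- The shifted argument contains no occurrence of the variable `0`, so all those listed in `w`
      -- come from `a'`.
      have hle : w.map (Atom.occ 0) ≤ a' := by
        obtain ⟨v', a', rfl⟩ := Cx.exists_ext a'
        obtain ⟨v'', a, rfl⟩ := Cx.exists_ext a
        rw [Cx.ext, Cx.ext, ← add_assoc, ← Multiset.map_add] at h₃
        change Cx.ext _ _ = (Cx.ext _ _ + _) at h₃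
        rw [← Cx.ext_zero, ← Cx.ext_add, Cx.ext_inj, add_zero] at h₃
        rw [Cx.ext, ← h₃.1, Multiset.map_add, add_assoc]
        exact Multiset.le_add_right _ _
      obtain ⟨a'', rfl⟩ := Multiset.le_iff_exists_add.1 hle
      rw [add_assoc, add_right_inj] at h₃
      subst h₃
      exact ⟨q ::ₘ w, a'', e + b, ⟨s, hs, by simpa using h₁⟩, ⟨e, b, q, w, rfl, rfl, he, hb⟩,
        by simp [add_assoc]⟩
    · rintro ⟨_, a, _, ⟨s, hs, h⟩, ⟨e, b, q, w, rfl, rfl, he, hb⟩, rfl⟩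
      obtain ⟨s', hs', h'⟩ := (den_lsubst s 0 t.shift _ p).2
        ⟨_, q, (Cx.up e), by simpa using h, den_shift.2 ⟨e, he, rfl⟩, rfl⟩
      exact ⟨w, a + (Cx.up e), b, ⟨s', ⟨s, hs, hs'⟩, by simpa [add_assoc] using h'⟩, hb,
        by simp [add_assoc]⟩

/-- The typings of a β-contractum. -/
theorem den_beta {s : Tm} {L : List Tm} {N : Term} {c : Cx D} {p : D} :
    (∃ s' ∈ Tm.beta s L N, den 𝓜 s' c p) ↔ ∃ u v a b d, c = a + b + d ∧
      den 𝓜 s (Cx.ext (u + v) a) p ∧ denLin 𝓜 L b u ∧ Bind (fun q e => denSum 𝓜 N e q) v d := by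
  simp only [Tm.beta, List.mem_flatMap]
  constructor
  · rintro ⟨s', ⟨s₁, hs₁, hs'⟩, h⟩
    obtain ⟨e, he, h⟩ := (den_subst s₁ _ _ _).1 ⟨s', hs', h⟩
    obtain ⟨w, a, b, ⟨s₀, hs₀, h₀⟩, hb, rfl⟩ := den_foldl_lsubst.1 ⟨s₁, hs₁, he⟩
    obtain rfl := List.mem_singleton.1 hs₀
    obtain ⟨v, a, rfl⟩ := Cx.exists_ext a
    rw [← Cx.ext_zero, ← Cx.ext_add, add_zero] at h
    obtain ⟨d, rfl, hd⟩ := bind_single_ext.1 h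
    refine ⟨w, v, a, b, d, rfl, ?_, hb, hd⟩
    rwa [Cx.ext, ← add_assoc, ← Multiset.map_add] at h₀
  · rintro ⟨u, v, a, b, d, rfl, h, hb, hd⟩
    obtain ⟨s₁, hs₁, h₁⟩ := (den_foldl_lsubst (S := [s]) (L := L)).2
      ⟨u, Cx.ext v a, b, ⟨s, by simp, by rwa [Cx.ext, ← add_assoc, ← Multiset.map_add]⟩, hb, rfl⟩
    obtain ⟨s', hs', h'⟩ := (den_subst s₁ (single N) (a + b + d) p).2 ⟨_, h₁, by
      rw [← Cx.ext_zero, ← Cx.ext_add, add_zero]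
      exact bind_single_ext.2 ⟨d, rfl, hd⟩⟩
    exact ⟨s', ⟨s₁, hs₁, hs'⟩, h'⟩

/-! ## Invariance of typing under outer-head reduction -/

/-- `k` units of weight. -/
def Cx.ticks (k : ℕ) : Cx D := Multiset.replicate k .tick

theorem Cx.ticks_zero : (Cx.ticks 0 : Cx D) = 0 := rfl

theorem Cx.ticks_succ (k : ℕ) : (Cx.ticks (k + 1) : Cx D) = .tick ::ₘ Cx.ticks k := rfl

theorem Cx.ext_ticks (v : Multiset D) (k : ℕ) (c : Cx D) :
    Cx.ext v (Cx.ticks k + c) = Cx.ticks k + Cx.ext v c := by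
  induction k with
  | zero => simp [Cx.ticks_zero]
  | succ k ih => rw [Cx.ticks_succ, Multiset.cons_add, Cx.ext_tick, ih, Multiset.cons_add]

/-- Weighted typing of simple tests. -/
def denTest (𝓜 : Model D) (Q : STest) (c : Cx D) : Prop :=
  ∃ u, denLin 𝓜 Q c u ∧ ∀ q ∈ u, 𝓜.isStar q

theorem denTest_nil {c : Cx D} : denTest 𝓜 [] c ↔ c = 0 := by
  simp [denTest, denLin]

theorem denTest_cons {t : Tm} {Q : STest} {c : Cx D} : denTest 𝓜 (t :: Q) c ↔
    ∃ a b p, c = a + b ∧ 𝓜.isStar p ∧ den 𝓜 t a p ∧ denTest 𝓜 Q b := by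
  simp only [denTest, denLin]
  constructor
  · rintro ⟨_, ⟨a, b, p, w, rfl, rfl, h, h'⟩, hu⟩
    exact ⟨a, b, p, rfl, hu p (by simp), h, w, h', fun q hq => hu q (by simp [hq])⟩
  · rintro ⟨a, b, p, rfl, hp, h, w, h', hu⟩
    exact ⟨p ::ₘ w, ⟨a, b, p, w, rfl, rfl, h, h'⟩, by simpa using ⟨hp, hu⟩⟩

theorem denTest_append {Q R : STest} {c : Cx D} : denTest 𝓜 (Q ++ R) c ↔
    ∃ a b, c = a + b ∧ denTest 𝓜 Q a ∧ denTest 𝓜 R b := by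
  induction Q generalizing c with
  | nil => simp [denTest_nil]
  | cons t Q ih =>
    simp only [List.cons_append, denTest_cons, ih]
    constructor
    · rintro ⟨a, _, p, rfl, hp, h, b, d, rfl, h₁, h₂⟩
      exact ⟨a + b, d, by abel, ⟨a, b, p, rfl, hp, h, h₁⟩, h₂⟩
    · rintro ⟨_, d, rfl, ⟨a, b, p, rfl, hp, h, h₁⟩, h₂⟩
      exact ⟨a, b + d, p, by abel, hp, h, b, d, rfl, h₁, h₂⟩

theorem den_taubar {Q : STest} {c : Cx D} {p : D} : den 𝓜 (.taubar Q) c p ↔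
    𝓜.isStar p ∧ ∃ a, c = .tick ::ₘ a ∧ denTest 𝓜 Q a := by
  simp only [den, denTest]
  constructor
  · rintro ⟨h, a, u, rfl, h'⟩
    exact ⟨h, a, rfl, u, h'⟩
  · rintro ⟨h, a, rfl, u, h'⟩
    exact ⟨h, a, u, rfl, h'⟩

/-- The two units of weight are those of the application and the abstraction that the contraction
removes. Uniqueness of the decomposition of arrow types identifies the types demanded by the
abstraction with those supplied by the bag. -/
theorem den_app_lam {s : Tm} {L N : List Tm} {c : Cx D} {p : D} :
    den 𝓜 (.app (.lam s) L N) c p ↔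
      ∃ c', c = Cx.ticks 2 + c' ∧ ∃ s' ∈ Tm.beta s L N, den 𝓜 s' c' p := by
  simp only [den_beta, den]
  constructor
  · rintro ⟨_, b, d, u, v, rfl, ⟨w, q, a, h, rfl, hs⟩, hb, hd⟩
    obtain ⟨rfl, rfl⟩ := 𝓜.cons_inj h
    exact ⟨_, by simp [Cx.ticks], u, v, a, b, d, rfl, hs, hb, hd⟩
  · rintro ⟨_, rfl, u, v, a, b, d, rfl, hs, hb, hd⟩
    exact ⟨_, b, d, u, v, by simp [Cx.ticks], ⟨_, _, a, rfl, rfl, hs⟩, hb, hd⟩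

mutual
-- Subject expansion. It holds in every `Model`, since only closure of the types of tests under `[]
-- :: ·` is needed; this makes it available in the free model too.
theorem Tm.Step.den_of_mem {s : Tm} {S : Term} : Tm.Step s S → ∀ s' ∈ S, ∀ (c : Cx D) (p : D),
    den 𝓜 s' c p → ∃ k, den 𝓜 s (Cx.ticks k + c) p
  | .beta s L N => fun s' hs' c p h => ⟨2, den_app_lam.2 ⟨c, rfl, s', hs', h⟩⟩
  | .taubar_bang Q N => by
    intro s' hs' c p h
    obtain rfl := List.mem_singleton.1 hs'
    have h' := den_taubar.1 h
    obtain ⟨q, a, rfl, ha⟩ := h'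
    refine ⟨1, .tick ::ₘ a, 0, 0, 0, 0, by simp [Cx.ticks], ?_, ⟨rfl, rfl⟩, by simp⟩
    exact den_taubar.2 ⟨by simpa using 𝓜.isStar_cons q, a, rfl, ha⟩
  | .taubar_lin Q t L N => by simp
  | .lam hs => by
    intro s' hs' c p h
    obtain ⟨t, ht, rfl⟩ := List.mem_map.1 hs'
    obtain ⟨v, q, a, rfl, rfl, h⟩ := h
    obtain ⟨k, h⟩ := hs.den_of_mem t ht _ _ h
    exact ⟨k, v, q, Cx.ticks k + a, rfl, by simp, by rwa [Cx.ext_ticks]⟩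
  | .head L' N' hs => by
    intro s' hs' c p h
    obtain ⟨t, ht, rfl⟩ := List.mem_map.1 hs'
    obtain ⟨a, b, d, u, v, rfl, h₁, h₂⟩ := h
    obtain ⟨k, h₁⟩ := hs.den_of_mem t ht _ _ h₁
    exact ⟨k, _, b, d, u, v, by simp [add_assoc], h₁, h₂⟩
  | .arg L₁ L₂ N hv hs => by
    intro s' hs' c p h
    obtain ⟨t, ht, rfl⟩ := List.mem_map.1 hs'
    obtain ⟨a, b, d, u, v, rfl, h₁, h₂, h₃⟩ := h
    obtain ⟨b₁, _, u₁, _, rfl, rfl, h₄, b₂, b₃, q, u₂, rfl, rfl, h₅, h₆⟩ := denLin_append.1 h₂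
    obtain ⟨k, h₅⟩ := hs.den_of_mem t ht _ _ h₅
    refine ⟨k, a, _, d, _, v, ?_, h₁, denLin_append.2
      ⟨b₁, _, u₁, _, rfl, rfl, h₄, _, b₃, q, u₂, rfl, rfl, h₅, h₆⟩, h₃⟩
    rw [Multiset.add_cons]; congr 1; abel
  | .taubar hs => by
    intro s' hs' c p h
    obtain ⟨t, ht, rfl⟩ := List.mem_map.1 hs'
    obtain ⟨hp, a, rfl, h'⟩ := den_taubar.1 h
    obtain ⟨k, h⟩ := hs.denTest_of_mem t ht _ h'
    exact ⟨k, den_taubar.2 ⟨hp, _, by simp, h⟩⟩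
theorem STest.Step.denTest_of_mem {Q : STest} {S : Test} : STest.Step Q S →
    ∀ Q' ∈ S, ∀ (c : Cx D), denTest 𝓜 Q' c → ∃ k, denTest 𝓜 Q (Cx.ticks k + c)
  | .gamma Q₁ R Q₂ => by
    intro s' hs' c h
    obtain rfl := List.mem_singleton.1 hs'
    obtain ⟨_, c, rfl, h', h₃⟩ := denTest_append.1 h
    obtain ⟨a, b, rfl, h₁, h₂⟩ := denTest_append.1 h'
    refine ⟨1, denTest_append.2 ⟨a, _, ?_, h₁, denTest_cons.2 ⟨_, c, 𝓜.star, rfl,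
      𝓜.isStar_star, den_taubar.2 ⟨𝓜.isStar_star, b, rfl, h₂⟩, h₃⟩⟩⟩
    simp [Cx.ticks, add_assoc]
  | .tau Q₁ s Q₂ => by
    intro s' hs' c h
    obtain ⟨t, ht, rfl⟩ := List.mem_map.1 hs'
    obtain ⟨a, _, rfl, h₁, h₂⟩ := denTest_append.1 h
    obtain ⟨b, d, p, rfl, hp, h₂, h₃⟩ := denTest_cons.1 h₂
    obtain ⟨e, he, h₂⟩ := (den_subst s (single []) b p).1 ⟨t, ht, h₂⟩
    obtain ⟨v, e, rfl⟩ := Cx.exists_ext e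
    obtain ⟨d', rfl, hd'⟩ := bind_single_ext.1 h₂
    -- The bound variable is replaced by the empty sum, which has no type, so the derivation cannot
    -- use it.
    obtain rfl : v = 0 := by
      induction v using Multiset.induction with
      | empty => rfl
      | cons q v _ => simp [denSum] at hd'
    obtain rfl := Bind.zero_iff.1 hd'
    refine ⟨1, denTest_append.2 ⟨a, _, ?_, h₁, denTest_cons.2 ⟨_, d, _, rfl,
      𝓜.isStar_cons hp, ⟨0, p, e, rfl, rfl, he⟩, h₃⟩⟩⟩
    simp [Cx.ticks]
  | .head Q₁ Q₂ hs => by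
    intro s' hs' c h
    obtain ⟨t, ht, rfl⟩ := List.mem_map.1 hs'
    obtain ⟨a, _, rfl, h₁, h₂⟩ := denTest_append.1 h
    obtain ⟨b, d, p, rfl, hp, h₂, h₃⟩ := denTest_cons.1 h₂
    obtain ⟨k, h₂⟩ := hs.den_of_mem t ht _ _ h₂
    exact ⟨k, denTest_append.2 ⟨a, _, by abel, h₁, denTest_cons.2 ⟨_, d, p, rfl, hp, h₂, h₃⟩⟩⟩
end

/-- The types of tests of the model are, coinductively, the sequences of empty multisets. -/
def Model.Strict (𝓜 : Model D) : Prop := ∀ v p, 𝓜.isStar (𝓜.cons v p) → v = 0 ∧ 𝓜.isStar p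

mutual
-- Subject reduction with a strict loss of weight: a derivation selects one summand of the reduct.
-- Strictness is what the rules for `τ` and `τ̄` require, as a type of tests must not demand
-- arguments.
theorem Tm.Step.den_forward (hM : 𝓜.Strict) {s : Tm} {S : Term} : Tm.Step s S →
    ∀ (c : Cx D) (p : D), den 𝓜 s c p →
      ∃ s' ∈ S, ∃ k c', c = Cx.ticks (k + 1) + c' ∧ den 𝓜 s' c' p
  | .beta s L N => fun c p h => by
    obtain ⟨c', rfl, s', hs', h⟩ := den_app_lam.1 h
    exact ⟨s', hs', 1, c', rfl, h⟩
  | .taubar_bang Q N => by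
    rintro c p ⟨a, _, d, _, v, rfl, h, ⟨rfl, rfl⟩, hd⟩
    obtain ⟨hp, a, rfl, h'⟩ := den_taubar.1 h
    obtain ⟨hv, hp'⟩ := hM _ _ hp
    obtain rfl : v = 0 := by simpa using hv
    obtain rfl := Bind.zero_iff.1 hd
    exact ⟨_, by simp, 0, _, by simp [Cx.ticks], den_taubar.2 ⟨hp', a, rfl, h'⟩⟩
  | .taubar_lin Q t L N => by
    rintro c p ⟨a, _, d, _, v, rfl, h, ⟨_, _, _, _, rfl, rfl, _⟩, hd⟩
    obtain ⟨hp, a, rfl, h⟩ := den_taubar.1 h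
    -- The type of `τ̄(Q)` has empty first entry, while the linear argument contributes a type to
    -- it; the case is void.
    obtain ⟨hv, hp⟩ := hM _ _ hp
    simp at hv
  | .lam hs => by
    rintro c p ⟨v, q, a, rfl, rfl, h⟩
    obtain ⟨s', hs', k, c', h', h''⟩ := hs.den_forward hM _ _ h
    obtain ⟨w, c', rfl⟩ := Cx.exists_ext c'
    rw [← Cx.ext_ticks, Cx.ext_inj] at h'
    obtain ⟨rfl, rfl⟩ := h'
    exact ⟨_, List.mem_map.2 ⟨s', hs', rfl⟩, k, .tick ::ₘ c', by simp, v, q, c', rfl, rfl, h''⟩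
  | .head L' N' hs => by
    rintro c p ⟨_, b, d, u, v, rfl, h₁, h₂⟩
    obtain ⟨s', hs', k, a, rfl, h₁'⟩ := hs.den_forward hM _ _ h₁
    exact ⟨_, List.mem_map.2 ⟨s', hs', rfl⟩, k, .tick ::ₘ (a + b + d), by simp [add_assoc],
      a, b, d, u, v, rfl, h₁', h₂⟩
  | .arg L₁ L₂ N hv hs => by
    rintro c p ⟨a, _, d, _, v, rfl, h₁, h₂, h₃⟩
    obtain ⟨b₁, _, u₁, _, rfl, rfl, h₄, _, b₃, q, u₂, rfl, rfl, h₅, h₆⟩ := denLin_append.1 h₂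
    obtain ⟨s', hs', k, b₂, rfl, h₅'⟩ := hs.den_forward hM _ _ h₅
    refine ⟨_, List.mem_map.2 ⟨s', hs', rfl⟩, k, .tick ::ₘ (a + (b₁ + (b₂ + b₃)) + d), ?_,
      a, _, d, _, v, rfl, h₁, denLin_append.2
      ⟨b₁, _, u₁, _, rfl, rfl, h₄, b₂, b₃, q, u₂, rfl, rfl, h₅', h₆⟩, h₃⟩
    rw [Multiset.add_cons]; congr 1; abel
  | .taubar hs => by
    intro c p h
    obtain ⟨hp, a, rfl, h'⟩ := den_taubar.1 h
    obtain ⟨Q', hQ', k, a, rfl, h''⟩ := hs.denTest_forward hM _ h'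
    exact ⟨_, List.mem_map.2 ⟨Q', hQ', rfl⟩, k, .tick ::ₘ a, by simp,
      den_taubar.2 ⟨hp, a, rfl, h''⟩⟩
theorem STest.Step.denTest_forward (hM : 𝓜.Strict) {Q : STest} {S : Test} : STest.Step Q S →
    ∀ (c : Cx D), denTest 𝓜 Q c → ∃ Q' ∈ S, ∃ k c', c = Cx.ticks (k + 1) + c' ∧ denTest 𝓜 Q' c'
  | .gamma Q₁ R Q₂ => by
    intro c h
    obtain ⟨a, _, rfl, h₁, h'⟩ := denTest_append.1 h
    obtain ⟨_, b, p, rfl, hp, h₂, h₃⟩ := denTest_cons.1 h'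
    obtain ⟨_, d, rfl, h₂'⟩ := den_taubar.1 h₂
    exact ⟨_, by simp, 0, a + d + b, by simp [Cx.ticks, add_assoc],
      denTest_append.2 ⟨_, b, rfl, denTest_append.2 ⟨a, d, rfl, h₁, h₂'⟩, h₃⟩⟩
  | .tau Q₁ s Q₂ => by
    intro c h
    obtain ⟨a, _, rfl, h₁, h'⟩ := denTest_append.1 h
    obtain ⟨_, b, p, rfl, hp, ⟨v, q, e, rfl, rfl, h₂⟩, h₃⟩ := denTest_cons.1 h'
    obtain ⟨rfl, hq⟩ := hM _ _ hp
    obtain ⟨s', hs', h₂⟩ := (den_subst s (single []) e q).2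
      ⟨_, h₂, bind_single_ext.2 ⟨0, by simp, by simp⟩⟩
    exact ⟨_, List.mem_map.2 ⟨s', hs', rfl⟩, 0, a + (e + b), by simp [Cx.ticks],
      denTest_append.2 ⟨a, _, rfl, h₁, denTest_cons.2 ⟨e, b, q, rfl, hq, h₂, h₃⟩⟩⟩
  | .head Q₁ Q₂ hs => by
    intro c h
    obtain ⟨a, _, rfl, h₁, h'⟩ := denTest_append.1 h
    obtain ⟨_, b, p, rfl, hp, h₂, h₃⟩ := denTest_cons.1 h'
    obtain ⟨s', hs', k, e, rfl, h₂'⟩ := hs.den_forward hM _ _ h₂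
    exact ⟨_, List.mem_map.2 ⟨s', hs', rfl⟩, k, a + (e + b), by abel,
      denTest_append.2 ⟨a, _, rfl, h₁, denTest_cons.2 ⟨e, b, p, rfl, hp, h₂', h₃⟩⟩⟩
end

/-! ## Normal forms -/

theorem exists_denLin {L : List Tm} (h : ∀ t ∈ L, ∃ (c : Cx D) (p : D), den 𝓜 t c p) :
    ∃ c u, denLin 𝓜 L c u := by
  induction L with
  | nil => exact ⟨0, 0, rfl, rfl⟩
  | cons t L ih =>
    obtain ⟨a, p, ha⟩ := h t (by simp)
    obtain ⟨b, u, hb⟩ := ih fun t ht => h t (by simp [ht])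
    exact ⟨_, _, a, b, p, u, rfl, rfl, ha, hb⟩

theorem exists_denTest {Q : STest} (h : ∀ t ∈ Q, ∃ c : Cx D, den 𝓜 t c 𝓜.star) :
    ∃ c, denTest 𝓜 Q c := by
  induction Q with
  | nil => exact ⟨0, denTest_nil.2 rfl⟩
  | cons t L ih =>
    obtain ⟨a, ha⟩ := h t (by simp)
    obtain ⟨b, hb⟩ := ih fun t ht => h t (by simp [ht])
    exact ⟨_, denTest_cons.2 ⟨a, b, _, rfl, 𝓜.isStar_star, ha, hb⟩⟩

mutual
-- The type of the head variable is free to be chosen, so it can accept whatever types the linear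
-- arguments have and return any prescribed `p`. The banged parts are used zero times.
theorem Tm.Neutral.exists_den (𝓜 : Model D) {s : Tm} : Tm.Neutral s → ∀ p, ∃ c, den 𝓜 s c p
  | .var n => fun p => ⟨_, rfl⟩
  | .app N hs hL => fun p => by
    obtain ⟨b, u, hb⟩ := exists_denLin fun t ht => (hL t ht).exists_den 𝓜
    obtain ⟨a, ha⟩ := hs.exists_den 𝓜 (𝓜.cons (u + 0) p)
    exact ⟨_, a, b, 0, u, 0, rfl, ha, hb, by simp⟩
theorem Tm.Normal.exists_den (𝓜 : Model D) {s : Tm} : Tm.Normal s → ∃ c p, den 𝓜 s c p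
  | .neutral h => by
    obtain ⟨c, h⟩ := h.exists_den 𝓜 𝓜.star
    exact ⟨c, _, h⟩
  | .taubar h => by
    obtain ⟨c, h⟩ := exists_denTest fun t ht => (h t ht).exists_den 𝓜 𝓜.star
    exact ⟨_, _, den_taubar.2 ⟨𝓜.isStar_star, c, rfl, h⟩⟩
  | .lam h => by
    obtain ⟨c, p, h⟩ := h.exists_den 𝓜
    obtain ⟨v, c, rfl⟩ := Cx.exists_ext c
    exact ⟨_, _, v, p, c, rfl, rfl, h⟩
end

theorem Tm.Neutral.varHeaded {s : Tm} (h : Tm.Neutral s) : Tm.VarHeaded s := by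
  induction s using Tm.induct with
  | var n => exact .var n
  | app s L N ih _ _ => cases h with | app _ h _ => exact .app _ _ (ih h)
  | lam s ih => cases h
  | taubar Q ih => cases h

theorem Tm.Normal.neutral_of_app {s : Tm} {L N : List Tm} (h : Tm.Normal (.app s L N)) :
    Tm.Neutral (.app s L N) := by
  cases h with | neutral h => exact h

/-- Progress: outer-head reduction is stuck only at the normal forms, so a decreasing weight
suffices for convergence. -/
theorem Tm.normal_or_step (s : Tm) : Tm.Normal s ∨ ∃ S, Tm.Step s S := by
  induction s using Tm.induct with
  | var n => exact .inl (.neutral (.var n))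
  | lam s ih => exact ih.imp .lam fun ⟨S, h⟩ => ⟨_, .lam h⟩
  | app s L N ihs ihL _ =>
    have arg (hs : Tm.Neutral s) : Tm.Normal (.app s L N) ∨ ∃ S, Tm.Step (.app s L N) S := by
      by_cases hL : ∀ t ∈ L, Tm.Normal t
      · exact .inl (.neutral (.app N hs hL))
      · push Not at hL
        obtain ⟨t, ht, hn⟩ := hL
        obtain ⟨S, h⟩ := (ihL t ht).resolve_left hn
        obtain ⟨L₁, L₂, rfl⟩ := List.append_of_mem ht
        exact .inr ⟨_, .arg L₁ L₂ N hs.varHeaded h⟩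
    cases s with
    | var n => exact arg (.var n)
    | lam s => exact .inr ⟨_, .beta s L N⟩
    | app s L' N' => exact ihs.elim (fun h => arg h.neutral_of_app) <|
        fun ⟨S, h⟩ => .inr ⟨_, .head L N h⟩
    | taubar Q =>
      cases L with
      | nil => exact .inr ⟨_, .taubar_bang Q N⟩
      | cons t L => exact .inr ⟨_, .taubar_lin Q t L N⟩
  | taubar Q ih =>
    by_cases hQ : ∀ t ∈ Q, Tm.Neutral t
    · exact .inl (.taubar hQ)
    · push Not at hQ
      obtain ⟨t, ht, hn⟩ := hQ
      have iht := ih t ht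
      obtain ⟨Q₁, Q₂, rfl⟩ := List.append_of_mem ht
      cases t with
      | var n => exact absurd (.var n) hn
      | lam s => exact .inr ⟨_, .taubar (.tau Q₁ s Q₂)⟩
      | app s L N =>
        obtain ⟨S, h⟩ := iht.resolve_left fun h => hn h.neutral_of_app
        exact .inr ⟨_, .taubar (.head Q₁ Q₂ h)⟩
      | taubar R => exact .inr ⟨_, .taubar (.gamma Q₁ R Q₂)⟩

/-! ## Adequacy -/

theorem Term.Step.exists_den {M M' : Term} (h : Term.Step M M')
    (hM : ∃ s ∈ M', ∃ (c : Cx D) (p : D), den 𝓜 s c p) :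
    ∃ s ∈ M, ∃ (c : Cx D) (p : D), den 𝓜 s c p := by
  obtain @⟨s, S, U, V, h⟩ := h
  obtain ⟨t, ht, c, p, hc⟩ := hM
  simp only [List.mem_append] at ht
  rcases ht with (ht | ht) | ht
  · exact ⟨t, by simp [ht], c, p, hc⟩
  · obtain ⟨k, hk⟩ := h.den_of_mem t ht c p hc
    exact ⟨s, by simp, _, p, hk⟩
  · exact ⟨t, by simp [ht], c, p, hc⟩

/-- Typings of a normal summand are pulled back along the reduction. No strictness is assumed, so
convergence yields free types as well as points of `M∞`. -/
theorem Term.Converges.exists_den (𝓜 : Model D) {M : Term} (h : M.Converges) :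
    ∃ s ∈ M, ∃ c p, den 𝓜 s c p := by
  obtain ⟨M', hM, s, hs, h⟩ := h
  have : ∃ s ∈ M', ∃ c p, den 𝓜 s c p := ⟨s, hs, h.exists_den 𝓜⟩
  induction hM using Relation.ReflTransGen.head_induction_on with
  | refl => exact this
  | head h _ ih => exact h.exists_den ih

theorem Test.Step.exists_denTest {M M' : Test} (h : Test.Step M M')
    (hM : ∃ q ∈ M', ∃ c : Cx D, denTest 𝓜 q c) : ∃ q ∈ M, ∃ c : Cx D, denTest 𝓜 q c := by
  obtain @⟨s, S, U, V, h⟩ := h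
  obtain ⟨t, ht, c, hc⟩ := hM
  simp only [List.mem_append] at ht
  rcases ht with (ht | ht) | ht
  · exact ⟨t, by simp [ht], c, hc⟩
  · obtain ⟨k, hk⟩ := h.denTest_of_mem t ht c hc
    exact ⟨s, by simp, _, hk⟩
  · exact ⟨t, by simp [ht], c, hc⟩

theorem Test.Converges.exists_denTest (𝓜 : Model D) {Q : Test} (h : Q.Converges) :
    ∃ q ∈ Q, ∃ c, denTest 𝓜 q c := by
  obtain ⟨M', hM, s, hs, h⟩ := h
  have : ∃ q ∈ M', ∃ c, denTest 𝓜 q c :=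
    ⟨s, hs, ResourceCalculus.exists_denTest fun t ht => (h t ht).exists_den 𝓜 𝓜.star⟩
  induction hM using Relation.ReflTransGen.head_induction_on with
  | refl => exact this
  | head h _ ih => exact h.exists_denTest ih

/-- Induction on the weight: one follows the summand that carries the derivation, and each step
loses at least one unit. -/
theorem Term.converges_of_den (hM : 𝓜.Strict) {M : Term} {s : Tm} (hs : s ∈ M) {c : Cx D} {p : D}
    (h : den 𝓜 s c p) : M.Converges := by
  classical
  induction hn : c.count .tick using Nat.strong_induction_on generalizing M s c with
  | _ n ih =>
    rcases s.normal_or_step with hN | ⟨S, hS⟩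
    · exact ⟨M, .refl, s, hs, hN⟩
    · obtain ⟨s', hs', k, c', rfl, h'⟩ := hS.den_forward hM c p h
      obtain ⟨U, V, rfl⟩ := List.append_of_mem hs
      have hlt : c'.count .tick < n := by
        rw [← hn, Cx.ticks, Multiset.count_add, Multiset.count_replicate_self]; omega
      obtain ⟨M', hM', h'⟩ := ih _ hlt (M := U ++ S ++ V) (s := s') (by simp [hs']) h' rfl
      exact ⟨M', .head (.mk U V hS) hM', h'⟩

/-! ## Underlying environments -/

/-- The type given to the variable `n` by an element of a context. -/
def Atom.typ (n : ℕ) : Atom D → Multiset D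
  | .tick => 0
  | .occ m p => Pi.single (M := fun _ => Multiset D) m {p} n

/-- The type environment that underlies a weighted context. -/
def toEnv (c : Cx D) (n : ℕ) : Multiset D := (c.map (Atom.typ n)).sum

@[simp] theorem toEnv_zero : toEnv (0 : Cx D) = 0 := rfl

@[simp] theorem toEnv_add (a b : Cx D) : toEnv (a + b) = toEnv a + toEnv b := by
  funext n; simp [toEnv]

@[simp] theorem toEnv_tick (c : Cx D) : toEnv (.tick ::ₘ c) = toEnv c := by
  funext n; simp [toEnv, Atom.typ]

@[simp] theorem toEnv_occ (n : ℕ) (p : D) (c : Cx D) :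
    toEnv (.occ n p ::ₘ c) = Pi.single n {p} + toEnv c := by
  funext m; simp [toEnv, Atom.typ]

@[simp] theorem toEnv_singleton (n : ℕ) (p : D) :
    toEnv ({.occ n p} : Cx D) = Pi.single n {p} := by
  rw [← Multiset.cons_zero, toEnv_occ]; simp

@[simp] theorem toEnv_ticks (k : ℕ) (c : Cx D) : toEnv (Cx.ticks k + c) = toEnv c := by
  induction k with
  | zero => simp [Cx.ticks_zero]
  | succ k ih => rw [Cx.ticks_succ, Multiset.cons_add, toEnv_tick, ih]

@[simp] theorem toEnv_up_zero (c : Cx D) : toEnv c.up 0 = 0 := by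
  induction c using Multiset.induction with
  | empty => simp
  | cons x c ih => cases x <;> simp [ih]

@[simp] theorem toEnv_up_succ (c : Cx D) (n : ℕ) : toEnv c.up (n + 1) = toEnv c n := by
  induction c using Multiset.induction with
  | empty => simp
  | cons x c ih => cases x <;> simp [ih, Pi.single_apply]

@[simp] theorem toEnv_ext_zero (v : Multiset D) (c : Cx D) : toEnv (Cx.ext v c) 0 = v := by
  induction v using Multiset.induction with
  | empty => simp
  | cons p v ih => simp [ih]

@[simp] theorem toEnv_ext_succ (v : Multiset D) (c : Cx D) (n : ℕ) :
    toEnv (Cx.ext v c) (n + 1) = toEnv c n := by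
  induction v using Multiset.induction with
  | empty => simp
  | cons p v ih => simp [ih]

theorem Env.extend_toEnv (v : Multiset MInf) (c : Cx MInf) :
    Env.extend v (toEnv c) = toEnv (Cx.ext v c) := by
  funext n; cases n <;> simp [Env.extend]

theorem Env.extend_inj {v w : Multiset MInf} {Γ Δ : Env}
    (h : Env.extend v Γ = Env.extend w Δ) : v = w ∧ Γ = Δ :=
  ⟨congr_fun h 0, funext fun n => congr_fun h (n + 1)⟩

/-! ## The weighted presentation of the interpretation -/

theorem MInf.cons_inj {v w : Multiset MInf} {p q : MInf} (h : MInf.cons v p = MInf.cons w q) :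
    v = w ∧ p = q := by
  have := congrArg MInf.dest h
  rw [MInf.dest_cons, MInf.dest_cons] at this
  exact Prod.ext_iff.1 this

/-- `M∞` as a model of weighted typing. -/
noncomputable def mInf : Model MInf where
  cons := MInf.cons
  cons_inj := MInf.cons_inj
  isStar p := p = MInf.star
  star := MInf.star
  isStar_star := rfl
  isStar_cons h := by rw [h, MInf.cons_zero_star]

theorem mInf_strict : mInf.Strict := by
  intro v p (h : MInf.cons v p = MInf.star)
  rw [← MInf.cons_zero_star] at h
  exact MInf.cons_inj h

mutual
-- With `HasType.of_den`, this transfers results between the weighted typing and the interpretation: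
-- the environments of the latter are weighted contexts with the weight forgotten.
theorem HasType.exists_den {Γ : Env} {s : Tm} {p : MInf} :
    HasType Γ s p → ∃ c, toEnv c = Γ ∧ den mInf s c p
  | .var n p => ⟨_, toEnv_singleton n p, rfl⟩
  | .lam h => by
    obtain ⟨c, hc, h'⟩ := h.exists_den
    obtain ⟨w, c, rfl⟩ := Cx.exists_ext c
    rw [← Env.extend_toEnv] at hc
    obtain ⟨rfl, rfl⟩ := Env.extend_inj hc
    exact ⟨.tick ::ₘ c, by simp, w, _, c, rfl, rfl, h'⟩
  | .app h hB => by
    obtain ⟨a, rfl, ha⟩ := h.exists_den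
    obtain ⟨b, d, u, v, rfl, rfl, hb, hd⟩ := hB.exists_den
    exact ⟨.tick ::ₘ (a + b + d), by simp [add_assoc], a, b, d, u, v, rfl, ha, hb, hd⟩
  | .taubar h => by
    obtain ⟨c, rfl, h'⟩ := h.exists_den
    exact ⟨.tick ::ₘ c, by simp, den_taubar.2 ⟨rfl, c, rfl, h'⟩⟩
theorem BagHasType.exists_den {Γ : Env} {L N : List Tm} {w : Multiset MInf} :
    BagHasType Γ L N w → ∃ b d u v, toEnv b + toEnv d = Γ ∧ w = u + v ∧ denLin mInf L b u ∧
      Bind (fun q e => denSum mInf N e q) v d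
  | .nil N => ⟨0, 0, 0, 0, by simp, by simp, ⟨rfl, rfl⟩, by simp⟩
  | .bang ht h hB => by
    obtain ⟨a, rfl, ha⟩ := h.exists_den
    obtain ⟨_, d, _, v, rfl, rfl, ⟨rfl, rfl⟩, hd⟩ := hB.exists_den
    exact ⟨0, a + d, 0, _ ::ₘ v, by simp, by simp, ⟨rfl, rfl⟩,
      Bind.cons_iff.2 ⟨a, d, rfl, denSum_iff.2 ⟨_, ht, ha⟩, hd⟩⟩
  | .lin h hB => by
    obtain ⟨a, rfl, ha⟩ := h.exists_den
    obtain ⟨b, d, u, v, rfl, rfl, hb, hd⟩ := hB.exists_den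
    exact ⟨a + b, d, _ ::ₘ u, v, by simp [add_assoc], by simp, ⟨a, b, _, u, rfl, rfl, ha, hb⟩, hd⟩
theorem TestTyped.exists_den {Γ : Env} {Q : STest} :
    TestTyped Γ Q → ∃ c, toEnv c = Γ ∧ denTest mInf Q c
  | .eps => ⟨0, rfl, denTest_nil.2 rfl⟩
  | .par h hQ => by
    obtain ⟨a, rfl, ha⟩ := h.exists_den
    obtain ⟨b, rfl, hb⟩ := hQ.exists_den
    exact ⟨a + b, by simp, denTest_cons.2 ⟨a, b, _, rfl, rfl, ha, hb⟩⟩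
end

theorem bagHasType_of_den {L N : List Tm}
    (hL : ∀ t ∈ L, ∀ c p, den mInf t c p → HasType (toEnv c) t p)
    (hN : ∀ t ∈ N, ∀ c p, den mInf t c p → HasType (toEnv c) t p) {b d : Cx MInf}
    {u v : Multiset MInf} (hb : denLin mInf L b u)
    (hd : Bind (fun q e => denSum mInf N e q) v d) :
    BagHasType (toEnv b + toEnv d) L N (u + v) := by
  induction L generalizing b u with
  | nil =>
    obtain ⟨rfl, rfl⟩ := hb
    rw [toEnv_zero, zero_add, zero_add]
    induction v using Multiset.induction generalizing d with
    | empty =>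
      obtain rfl := Bind.zero_iff.1 hd
      exact .nil N
    | cons p v ih =>
      obtain ⟨a, d, rfl, ha, hd⟩ := Bind.cons_iff.1 hd
      obtain ⟨t, ht, ha⟩ := denSum_iff.1 ha
      rw [toEnv_add]
      exact .bang ht (hN t ht _ _ ha) (ih hd)
  | cons t L ih =>
    obtain ⟨a, b, p, u, rfl, rfl, ha, hb⟩ := hb
    rw [toEnv_add, add_assoc, Multiset.cons_add]
    exact .lin (hL t (by simp) _ _ ha) (ih (fun t ht => hL t (by simp [ht])) hb)

theorem HasType.of_den (s : Tm) : ∀ c p, den mInf s c p → HasType (toEnv c) s p := by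
  induction s using Tm.induct with
  | var n =>
    rintro c p rfl
    rw [toEnv_singleton]
    exact .var n p
  | lam s ih =>
    rintro c p ⟨v, q, a, rfl, rfl, h⟩
    rw [toEnv_tick]
    exact .lam (Env.extend_toEnv v a ▸ ih _ _ h)
  | app s L N ihs ihL ihN =>
    rintro c p ⟨a, b, d, u, v, rfl, ha, hb, hd⟩
    rw [toEnv_tick, toEnv_add, toEnv_add, add_assoc]
    exact .app (ihs _ _ ha) (bagHasType_of_den ihL ihN hb hd)
  | taubar Q ih =>
    intro c p h
    obtain ⟨rfl, a, rfl, h'⟩ := den_taubar.1 h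
    clear h
    rw [toEnv_tick]
    refine .taubar ?_
    induction Q generalizing a with
    | nil =>
      obtain rfl := denTest_nil.1 h'
      exact .eps
    | cons t Q ihQ =>
      obtain ⟨a, b, p, rfl, rfl, ha, hb⟩ := denTest_cons.1 h'
      rw [toEnv_add]
      exact .par (ih t (by simp) _ _ ha) (ihQ (fun t ht => ih t (by simp [ht])) b
        hb)

theorem Tm.Step.hasType {s : Tm} {S : Term} (h : Tm.Step s S) {s' : Tm} (hs : s' ∈ S) {Γ : Env}
    {p : MInf} (h' : HasType Γ s' p) : HasType Γ s p := by
  obtain ⟨c, rfl, hc⟩ := h'.exists_den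
  obtain ⟨k, hk⟩ := h.den_of_mem s' hs c p hc
  exact toEnv_ticks k c ▸ HasType.of_den s _ _ hk

/-- Adequacy: a term converges if and only if its interpretation is not empty. -/
theorem Term.converges_iff {M : Term} : M.Converges ↔ (interp M).Nonempty := by
  constructor
  · intro h
    obtain ⟨s, hs, c, p, h⟩ := h.exists_den mInf
    exact ⟨(toEnv c, p), s, hs, HasType.of_den s c p h⟩
  · rintro ⟨⟨Γ, p⟩, s, hs, h⟩
    obtain ⟨c, _, h⟩ := h.exists_den
    exact Term.converges_of_den mInf_strict hs h

/-! ## The reductions of `A` -/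

/-- `λu. u [(Θ [u!])!]`. -/
def tmThetaHead : Tm := .lam (.app (.var 0) [] [.app tmTheta [] [.var 0]])

/-- `λv w. w [I [v!]]`. -/
def tmBase : Tm := .lam (.lam (.app (.var 0) [.app tmI [] [.var 1]] []))

/-- `λv w. A [(v [w!])!]`. -/
def tmNext : Tm := .lam (.lam (.app tmA [] [.app (.var 1) [] [.var 0]]))

theorem step_tmTheta : Tm.Step tmTheta [tmThetaHead] := .beta _ _ _

theorem step_tmA : Tm.Step tmA [.app tmThetaHead [tmF] [tmH]] := .head _ _ step_tmTheta

/-- The single linear argument `tmF` goes either to the head occurrence of `u` or, through a linear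
copy of `Θ [u!]`, into the bag; the second choice recreates `A = Θ [tmF ; tmH!]` as the linear
argument of `tmH`. -/
theorem step_thetaHead : Tm.Step (.app tmThetaHead [tmF] [tmH])
    [.app tmF [] [.app tmTheta [] [tmH]], .app tmH [tmA] [.app tmTheta [] [tmH]]] := .beta _ _ _

theorem step_tmF : Tm.Step (.app tmF [] [.app tmTheta [] [tmH]]) [tmBase] := .beta _ _ _

theorem step_tmH : Tm.Step (.app tmH [tmA] [.app tmTheta [] [tmH]]) [tmNext] := .beta _ _ _

theorem HasType.tmA_of_base {Γ : Env} {p : MInf} (h : HasType Γ tmBase p) : HasType Γ tmA p :=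
  step_tmA.hasType (by simp) (step_thetaHead.hasType (by simp) (step_tmF.hasType (by simp) h))

theorem HasType.tmA_of_next {Γ : Env} {p : MInf} (h : HasType Γ tmNext p) : HasType Γ tmA p :=
  step_tmA.hasType (by simp) (step_thetaHead.hasType (List.mem_cons_of_mem _ (by simp))
    (step_tmH.hasType (by simp) h))

theorem Cx.count_tick_ext [DecidableEq (Atom MInf)] (v : Multiset MInf) (c : Cx MInf) :
    (Cx.ext v c).count .tick = c.count .tick := by
  induction v using Multiset.induction with
  | empty =>
    induction c using Multiset.induction with
    | empty => simp
    | cons x c ih =>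
      rw [Cx.ext_zero] at ih ⊢
      cases x <;> simp [ih]
  | cons p v ih => simp [ih]

/-- Rewriting `*` as `[] :: *` forces the second bound variable to have no typed occurrence, and the
body to have type `*` again. -/
theorem den_lam_lam_star [DecidableEq (Atom MInf)] {s : Tm} {c : Cx MInf} {v : Multiset MInf}
    (h : den mInf (.lam (.lam s)) c (MInf.cons v MInf.star)) :
    ∃ b, den mInf s b MInf.star ∧ toEnv b 0 = 0 ∧ b.count .tick ≤ c.count .tick := by
  obtain ⟨v, q, a, h, rfl, w, r, b, rfl, ha, hs⟩ := h
  obtain ⟨rfl, h'⟩ := MInf.cons_inj h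
  replace h' := MInf.cons_zero_star.trans h'
  obtain ⟨rfl, rfl⟩ := MInf.cons_inj h'
  refine ⟨_, hs, by simp, ?_⟩
  have := congrArg (Multiset.count Atom.tick) ha
  rw [Cx.count_tick_ext] at this ⊢
  simp only [Multiset.count_cons_self] at this ⊢
  omega

/-- The second bound variable is the head of the body, hence it occurs at least once in any
derivation. -/
theorem not_den_tmBase {c : Cx MInf} {v : Multiset MInf} :
    ¬ den mInf tmBase c (MInf.cons v MInf.star) := by
  classical
  intro h
  obtain ⟨b, ⟨a, d, e, u, x, rfl, ha, -⟩, h, -⟩ := den_lam_lam_star h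
  rw [den] at ha
  subst ha
  simp at h

/-- Infinite descent on the weight: the summand `tmBase` is excluded, and in `tmNext` a lighter
derivation gives the inner `A` again a type of the form `v :: *`. -/
theorem not_den_tmA {c : Cx MInf} {v : Multiset MInf} :
    ¬ den mInf tmA c (MInf.cons v MInf.star) := by
  classical
  intro h
  induction hn : c.count .tick using Nat.strong_induction_on generalizing v c with
  | _ n ih =>
    obtain ⟨s, hs, k, c, rfl, h⟩ := step_tmA.den_forward mInf_strict _ _ h
    obtain rfl := List.mem_singleton.1 hs
    obtain ⟨s, hs, l, c, rfl, h⟩ := step_thetaHead.den_forward mInf_strict _ _ h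
    simp only [List.mem_cons, List.not_mem_nil, or_false] at hs
    rcases hs with rfl | rfl
    · obtain ⟨s, hs, m, c, rfl, h⟩ := step_tmF.den_forward mInf_strict _ _ h
      obtain rfl := List.mem_singleton.1 hs
      exact not_den_tmBase h
    · obtain ⟨s, hs, m, c, rfl, h⟩ := step_tmH.den_forward mInf_strict _ _ h
      obtain rfl := List.mem_singleton.1 hs
      obtain ⟨b, ⟨a, d, e, u, x, rfl, ha, -⟩, -, hle⟩ := den_lam_lam_star h
      refine ih _ ?_ ha rfl
      simp only [Multiset.count_cons_self, Multiset.count_add] at hn hle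
      omega

/-- `Delay p q`: the type `q` is `p` in which a tail `γ` has been replaced by `[[γ] :: β] :: β`. -/
inductive Delay : MInf → MInf → Prop
  | base (p q : MInf) : Delay p (.cons {.cons {p} q} q)
  | cons (a : Multiset MInf) {p q : MInf} : Delay p q → Delay (.cons a p) (.cons a q)

theorem BagHasType.bang_var (n : ℕ) (a : Multiset MInf) :
    BagHasType (Pi.single n a) [] [.var n] a := by
  induction a using Multiset.induction with
  | empty => rw [Pi.single_zero]; exact .nil _
  | cons p a ih =>
    have := BagHasType.bang (List.mem_singleton.2 rfl) (.var n p) ih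
    rwa [← Pi.single_add, Multiset.singleton_add] at this

theorem HasType.tmI (p : MInf) : HasType 0 tmI (.cons {p} p) := by
  refine .lam ?_
  convert HasType.var 0 p using 1
  funext n
  cases n <;> simp [Env.extend]

theorem Env.extend_extend_zero (v w : Multiset MInf) :
    Env.extend v (Env.extend w 0) = Pi.single 0 v + Pi.single 1 w := by
  funext n
  rcases n with _ | _ | n <;> simp [Env.extend]

/-- The two rules of `Delay` mirror the two summands to which `A` reduces: `tmBase` stops and asks
for the extra argument, of type `[p] :: q`, while `tmNext` passes one more argument to `v` and calls
`A` again. -/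
theorem HasType.tmA {p q : MInf} (h : Delay p q) : HasType 0 tmA (.cons {p} q) := by
  induction h with
  | base p q =>
    refine .tmA_of_base (.lam (.lam ?_))
    rw [Env.extend_extend_zero]
    have h := HasType.app (HasType.tmI p) (BagHasType.bang_var 1 {p})
    have := HasType.app (.var 0 (.cons {p} q)) (.lin h (.nil []))
    simpa using this
  | @cons a p q h ih =>
    refine .tmA_of_next (.lam (.lam ?_))
    rw [Env.extend_extend_zero]
    have h := HasType.app (.var 1 (.cons a p)) (BagHasType.bang_var 0 a)
    have := HasType.app ih (.bang (List.mem_singleton.2 rfl) h (.nil _))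
    simpa [add_comm] using this

/-! ## Relations compatible with the constructors -/

/-- Relations on terms and bags that the constructors of the λ-calculus with resources preserve. -/
structure Compatible (P : Term → Term → Prop) (R : Bag → Bag → Prop) : Prop where
  var (n : ℕ) : P [.var n] [.var n]
  lam {M N : Term} : P M N → P (Term.lam M) (Term.lam N)
  app {M N : Term} {B B' : Bag} : P M N → R B B' → P (Term.app M B) (Term.app N B')
  nil : P [] []
  add {M N M' N' : Term} : P M N → P M' N' → P (M ++ M') (N ++ N')
  bag {L L' : List Term} {N N' : Term} : List.Forall₂ P L L' → P N N' →
    R (Bag.mk L N) (Bag.mk L' N')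
  bagNil : R [] []
  bagAdd {B C B' C' : Bag} : R B C → R B' C' → R (B ++ B') (C ++ C')

theorem sections_map_singleton {α : Type*} (L : List α) :
    (L.map fun x => [x]).sections = [L] := by
  induction L with
  | nil => rfl
  | cons x L ih => simp [List.sections, ih]

namespace Compatible

variable {P : Term → Term → Prop} {R : Bag → Bag → Prop} (h : Compatible P R)
include h

theorem term_refl' {M : Term} (hM : ∀ s ∈ M, P [s] [s]) : P M M := by
  induction M with
  | nil => exact h.nil
  | cons s M ih => exact h.add (hM s (by simp)) (ih fun t ht => hM t (by simp [ht]))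

theorem bag_refl' {L N : List Tm} (hL : ∀ s ∈ L, P [s] [s]) (hN : ∀ s ∈ N, P [s] [s]) :
    R [(L, N)] [(L, N)] := by
  have hb : Bag.mk (L.map fun s => [s]) N = [(L, N)] := by
    rw [Bag.mk, sections_map_singleton]; rfl
  rw [← hb]
  refine h.bag ?_ (h.term_refl' hN)
  rw [List.forall₂_map_left_iff, List.forall₂_map_right_iff, List.forall₂_same]
  exact hL

/-- Applied to reducibility this is the fundamental lemma. The case of `τ̄` is excluded by the
hypothesis, which is why `Compatible` needs no clause for tests. -/
theorem simple_refl {s : Tm} (hs : s.IsResource) : P [s] [s] := by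
  induction s using Tm.induct with
  | var n => exact h.var n
  | lam s ih => cases hs with | lam hs => exact h.lam (ih hs)
  | app s L N ihs ihL ihN =>
    cases hs with
    | app hs hL hN =>
      exact h.app (ihs hs)
        (h.bag_refl' (fun t ht => ihL t ht (hL t ht)) fun t ht => ihN t ht (hN t ht))
  | taubar Q _ => cases hs

theorem term_refl {M : Term} (hM : M.IsResource) : P M M :=
  h.term_refl' fun s hs => h.simple_refl (hM s hs)

theorem bag_refl {B : Bag} (hB : B.IsResource) : R B B := by
  induction B with
  | nil => exact h.bagNil
  | cons b B ih =>
    have hb := hB b (by simp)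
    exact h.bagAdd (h.bag_refl' (fun s hs => h.simple_refl (hb.1 s hs))
      fun s hs => h.simple_refl (hb.2 s hs)) (ih fun b hb => hB b (by simp [hb]))

theorem list_refl {L : List Term} (hL : ∀ M ∈ L, Term.IsResource M) : List.Forall₂ P L L :=
  List.forall₂_same.2 fun M hM => h.term_refl (hL M hM)

mutual
theorem plug {M N : Term} (hMN : P M N) {C : TermCtx} : C.IsResource → P (C.plug M) (C.plug N)
  | .hole => hMN
  | .lam hC => h.lam (plug hMN hC)
  | .appLeft hC hB => h.app (plug hMN hC) (h.bag_refl hB)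
  | .appRight hT hD => h.app (h.term_refl hT) (plugBag hMN hD)
  | .add hC hT => h.add (plug hMN hC) (h.term_refl hT)
theorem plugBag {M N : Term} (hMN : P M N) {D : BagCtx} : D.IsResource → R (D.plug M) (D.plug N)
  | .lin hC hL hT => h.bag (.cons (plug hMN hC) (h.list_refl hL)) (h.term_refl hT)
  | .bang hL hC => h.bag (h.list_refl hL) (plug hMN hC)
  | .add hD hB => h.bagAdd (plugBag hMN hD) (h.bag_refl hB)
end

end Compatible

/-! ## Inclusion of interpretations -/

/-- The interpretation of a bag. -/
def interpBag (B : Bag) : Set (Env × Multiset MInf) := {p | ∃ b ∈ B, BagHasType p.1 b.1 b.2 p.2}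

theorem mem_interpBag_mk {L : List Term} {N : Term} {Γ : Env} {w : Multiset MInf} :
    (Γ, w) ∈ interpBag (Bag.mk L N) ↔ ∃ l ∈ L.sections, BagHasType Γ l N w := by
  simp [interpBag, Bag.mk]

theorem mem_interp_lam {M : Term} {Γ : Env} {p : MInf} :
    (Γ, p) ∈ interp (Term.lam M) ↔
      ∃ v q, p = .cons v q ∧ (Env.extend v Γ, q) ∈ interp M := by
  simp only [interp, Term.lam, List.mem_map, Set.mem_ofPred_eq]
  constructor
  · rintro ⟨_, ⟨s, hs, rfl⟩, h⟩
    cases h with | lam h => exact ⟨_, _, rfl, s, hs, h⟩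
  · rintro ⟨v, q, rfl, s, hs, h⟩
    exact ⟨_, ⟨s, hs, rfl⟩, .lam h⟩

theorem mem_interp_app {M : Term} {B : Bag} {Γ : Env} {p : MInf} :
    (Γ, p) ∈ interp (Term.app M B) ↔
      ∃ Δ Δ' w, Γ = Δ + Δ' ∧ (Δ, .cons w p) ∈ interp M ∧ (Δ', w) ∈ interpBag B := by
  simp only [interp, interpBag, Term.app, List.mem_flatMap, List.mem_map, Set.mem_ofPred_eq]
  constructor
  · rintro ⟨_, ⟨s, hs, b, hb, rfl⟩, h⟩
    cases h with
    | app h₁ h₂ => exact ⟨_, _, _, rfl, ⟨s, hs, h₁⟩, b, hb, h₂⟩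
  · rintro ⟨_, _, _, rfl, ⟨s, hs, h₁⟩, b, hb, h₂⟩
    exact ⟨_, ⟨s, hs, b, hb, rfl⟩, .app h₁ h₂⟩

theorem BagHasType.mono_bang {N N' : Term} (h : interp N ⊆ interp N') {Γ : Env}
    {w : Multiset MInf} : BagHasType Γ [] N w → BagHasType Γ [] N' w
  | .nil _ => .nil _
  | .bang ht hs hB => by
    obtain ⟨t', ht', hs'⟩ := h (show (_, _) ∈ interp N from ⟨_, ht, hs⟩)
    exact .bang ht' hs' (hB.mono_bang h)
termination_by w.card
decreasing_by simp

theorem compatible_interp :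
    Compatible (fun M N => interp M ⊆ interp N) (fun B C => interpBag B ⊆ interpBag C) where
  var n := subset_rfl
  lam h := by
    rintro ⟨Γ, p⟩ hp
    obtain ⟨v, q, rfl, hq⟩ := mem_interp_lam.1 hp
    exact mem_interp_lam.2 ⟨v, q, rfl, h hq⟩
  app h h' := by
    rintro ⟨Γ, p⟩ hp
    obtain ⟨Δ, Δ', w, rfl, h₁, h₂⟩ := mem_interp_app.1 hp
    exact mem_interp_app.2 ⟨Δ, Δ', w, rfl, h h₁, h' h₂⟩
  nil := subset_rfl
  add h h' := by
    rintro ⟨Γ, p⟩ ⟨s, hs, hp⟩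
    rcases List.mem_append.1 hs with hs | hs
    · obtain ⟨t, ht, hp⟩ := h (show (Γ, p) ∈ interp _ from ⟨s, hs, hp⟩)
      exact ⟨t, List.mem_append_left _ ht, hp⟩
    · obtain ⟨t, ht, hp⟩ := h' (show (Γ, p) ∈ interp _ from ⟨s, hs, hp⟩)
      exact ⟨t, List.mem_append_right _ ht, hp⟩
  bag {L L' N N'} hL hN := by
    rintro ⟨Γ, w⟩ hp
    rw [mem_interpBag_mk] at hp ⊢
    induction hL generalizing Γ w with
    | nil =>
      obtain ⟨l, hl, hp⟩ := hp
      obtain rfl : l = [] := by simpa [List.sections] using hl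
      exact ⟨[], by simp [List.sections], hp.mono_bang hN⟩
    | cons hM hL ih =>
      obtain ⟨s, hs, m, hm, hp⟩ := exists_mem_sections_cons.1 hp
      cases hp with
      | lin h₁ h₂ =>
        obtain ⟨t, ht, h₁⟩ := hM (show (_, _) ∈ interp _ from ⟨s, hs, h₁⟩)
        obtain ⟨m', hm', h₂⟩ := ih _ _ ⟨m, hm, h₂⟩
        exact exists_mem_sections_cons.2 ⟨t, ht, m', hm', .lin h₁ h₂⟩
  bagNil := subset_rfl
  bagAdd h h' := by
    rintro ⟨Γ, p⟩ ⟨s, hs, hp⟩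
    rcases List.mem_append.1 hs with hs | hs
    · obtain ⟨t, ht, hp⟩ := h (show (Γ, p) ∈ interpBag _ from ⟨s, hs, hp⟩)
      exact ⟨t, List.mem_append_left _ ht, hp⟩
    · obtain ⟨t, ht, hp⟩ := h' (show (Γ, p) ∈ interpBag _ from ⟨s, hs, hp⟩)
      exact ⟨t, List.mem_append_right _ ht, hp⟩

/-- Compositionality carries the inclusion through the context, and by adequacy convergence is
nonemptiness. -/
theorem ObsLE.of_interp_subset {M N : Term} (h : interp M ⊆ interp N) : ObsLE M N := by
  intro C hC hM
  rw [Term.converges_iff] at hM ⊢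
  exact hM.mono (compatible_interp.plug h hC)

/-! ## Types without the equation `[] :: * = *` -/

/-- Free types; an arrow has a list of types on the left. -/
inductive FreeType : Type
  | base : FreeType
  | arrow : List FreeType → FreeType → FreeType

/-- The free model, in which every type is a type of tests. -/
noncomputable def freeModel : Model FreeType where
  cons v p := .arrow v.toList p
  cons_inj {v w p q} h := by
    injection h with h h'
    exact ⟨by rw [← v.coe_toList, h, w.coe_toList], h'⟩
  -- The largest choice makes closure under `[] :: ·` trivial. Strictness fails, but this model only
  -- serves to type converging terms.
  isStar _ := True
  star := .base
  isStar_star := trivial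
  isStar_cons _ := trivial

/-- The application of a set of points to a family of sets of points, each used once. -/
def appSet (X : Set MInf) (Y : Multiset (Set MInf)) : Set MInf :=
  {q | ∃ w, Multiset.Rel (· ∈ ·) w Y ∧ MInf.cons w q ∈ X}

theorem appSet_mono {X X' : Set MInf} (h : X ⊆ X') (Y : Multiset (Set MInf)) :
    appSet X Y ⊆ appSet X' Y := fun _ ⟨w, hw, hq⟩ => ⟨w, hw, h hq⟩

mutual
/-- The sets of points of `M∞` that are reducible of a free type. -/
def Reducible : FreeType → Set MInf → Prop
  | .base => fun X => X.Nonempty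
  | .arrow l β => fun X => ∀ Y, ReducibleList l Y → Reducible β (appSet X Y)
/-- The families of sets of points that are reducible of the types in a list. -/
def ReducibleList : List FreeType → Multiset (Set MInf) → Prop
  | [] => fun Y => Y = 0
  | α :: l => fun Y => ∃ X Z, Reducible α X ∧ ReducibleList l Z ∧ Y = X ::ₘ Z
end

theorem reducibleList_iff {l : List FreeType} {Y : Multiset (Set MInf)} :
    ReducibleList l Y ↔ Multiset.Rel Reducible (l : Multiset FreeType) Y := by
  induction l generalizing Y with
  | nil => simp [ReducibleList, Multiset.rel_zero_left]
  | cons α l ih =>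
    rw [← Multiset.cons_coe, Multiset.rel_cons_left]
    simp only [ReducibleList, ih]

theorem reducible_cons {v : Multiset FreeType} {β : FreeType} {X : Set MInf} :
    Reducible (freeModel.cons v β) X ↔
      ∀ Y, Multiset.Rel Reducible v Y → Reducible β (appSet X Y) := by
  simp only [freeModel, Reducible, reducibleList_iff, Multiset.coe_toList]

theorem Reducible.mono {X X' : Set MInf} (h : X ⊆ X') : ∀ {α}, Reducible α X → Reducible α X'
  | .base => fun hX => Set.Nonempty.mono h hX
  | .arrow _ _ => fun hX Y hY => (hX Y hY).mono (appSet_mono h Y)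

mutual
-- Both properties are needed at once: at an arrow, the first uses that argument sets have points to
-- choose from, and the second uses that some family of reducible arguments exists.
theorem reducible_univ_and_nonempty : ∀ α,
    Reducible α Set.univ ∧ ∀ X, Reducible α X → X.Nonempty
  | .base => ⟨⟨MInf.star, trivial⟩, fun _ h => h⟩
  | .arrow l β => by
    obtain ⟨h₁, h₂⟩ := reducible_univ_and_nonempty β
    obtain ⟨⟨Y, hY⟩, h₄⟩ := reducibleList_univ_and_nonempty l
    constructor
    · intro Z hZ
      obtain ⟨w, hw⟩ := h₄ Z hZ
      refine h₁.mono ?_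
      intro q _
      exact ⟨w, hw, trivial⟩
    · intro X hX
      obtain ⟨q, w, _, hq⟩ := h₂ _ (hX Y hY)
      exact ⟨_, hq⟩
theorem reducibleList_univ_and_nonempty : ∀ l, (∃ Y, ReducibleList l Y) ∧
    ∀ Y, ReducibleList l Y → ∃ w, Multiset.Rel (· ∈ ·) w Y
  | [] => ⟨⟨0, rfl⟩, fun Y h => ⟨0, by rw [show Y = 0 from h]; exact .zero⟩⟩
  | α :: l => by
    obtain ⟨h₁, h₂⟩ := reducible_univ_and_nonempty α
    obtain ⟨⟨Y, hY⟩, h₄⟩ := reducibleList_univ_and_nonempty l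
    refine ⟨⟨_, _, _, h₁, hY, rfl⟩, ?_⟩
    rintro _ ⟨X, Z, hX, hZ, rfl⟩
    obtain ⟨p, hp⟩ := h₂ X hX
    obtain ⟨w, hw⟩ := h₄ Z hZ
    exact ⟨p ::ₘ w, .cons hp hw⟩
end

/-- The heart of the counter-example. Delaying under an arrow commutes with application, by
`Delay.cons`, so the delay can be pushed down to the base type, where only nonemptiness is asked and
`Delay.base` supplies a point. -/
theorem Reducible.delay {X : Set MInf} :
    ∀ {α}, Reducible α X → Reducible α {q | ∃ p ∈ X, Delay p q}
  | .base => fun ⟨p, hp⟩ => ⟨_, p, hp, .base p p⟩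
  | .arrow l β => fun h Y hY => (h Y hY).delay.mono <| by
    rintro q ⟨p, ⟨w, hw, hp⟩, hq⟩
    exact ⟨w, hw, _, hp, hq.cons w⟩

/-! ## Reducibility of interpretations -/

/-- The types of a term when its variables are used with types in given sets. -/
def valuation (N : Term) (ρ : ℕ → Multiset (Set MInf)) : Set MInf :=
  {q | ∃ Γ : Env, (Γ, q) ∈ interp N ∧ ∀ n, Multiset.Rel (· ∈ ·) (Γ n) (ρ n)}

/-- For every typing of `M` in the free model, the interpretation of `N` is reducible. -/
def TermReducible (M N : Term) : Prop :=
  ∀ s ∈ M, ∀ c α, den freeModel s c α → ∀ ρ : ℕ → Multiset (Set MInf),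
    (∀ n, Multiset.Rel Reducible (toEnv c n) (ρ n)) → Reducible α (valuation N ρ)

/-- For every typing of `B` in the free model, the interpretation of `C` is reducible. -/
def BagReducible (B C : Bag) : Prop :=
  ∀ b ∈ B, ∀ e d u v, denLin freeModel b.1 e u →
    Bind (fun q a => denSum freeModel b.2 a q) v d → ∀ ρ : ℕ → Multiset (Set MInf),
    (∀ n, Multiset.Rel Reducible ((toEnv e + toEnv d) n) (ρ n)) →
    ∃ Y, Multiset.Rel Reducible (u + v) Y ∧ ∀ w, Multiset.Rel (· ∈ ·) w Y →
      ∃ Γ : Env, (Γ, w) ∈ interpBag C ∧ ∀ n, Multiset.Rel (· ∈ ·) (Γ n) (ρ n)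

theorem exists_rel_add {α β : Type*} {r : α → β → Prop} {Γ Δ : ℕ → Multiset α}
    {ρ : ℕ → Multiset β} (h : ∀ n, Multiset.Rel r ((Γ + Δ) n) (ρ n)) :
    ∃ ρ₁ ρ₂, ρ = ρ₁ + ρ₂ ∧ (∀ n, Multiset.Rel r (Γ n) (ρ₁ n)) ∧
      ∀ n, Multiset.Rel r (Δ n) (ρ₂ n) := by
  choose ρ₁ ρ₂ h₁ h₂ h₃ using fun n => Multiset.rel_add_left.1 (h n)
  exact ⟨ρ₁, ρ₂, funext h₃, h₁, h₂⟩

theorem rel_add_env {α β : Type*} {r : α → β → Prop} {Γ Δ : ℕ → Multiset α}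
    {ρ₁ ρ₂ : ℕ → Multiset β} (h₁ : ∀ n, Multiset.Rel r (Γ n) (ρ₁ n))
    (h₂ : ∀ n, Multiset.Rel r (Δ n) (ρ₂ n)) (n : ℕ) :
    Multiset.Rel r ((Γ + Δ) n) ((ρ₁ + ρ₂) n) := (h₁ n).add (h₂ n)

/-- Each copy drawn from the bang contributes one reducible set to `Y`, namely the valuation of `N'`
at its share of `ρ`. The family is fixed before the points `w` are chosen, as application requires.
-/
theorem TermReducible.bang {N N' : Term} (hN : TermReducible N N') {d : Cx FreeType}
    {v : Multiset FreeType} (h : Bind (fun q a => denSum freeModel N a q) v d)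
    {ρ : ℕ → Multiset (Set MInf)} (hρ : ∀ n, Multiset.Rel Reducible (toEnv d n) (ρ n)) :
    ∃ Y, Multiset.Rel Reducible v Y ∧ ∀ w, Multiset.Rel (· ∈ ·) w Y →
      ∃ Γ : Env, BagHasType Γ [] N' w ∧ ∀ n, Multiset.Rel (· ∈ ·) (Γ n) (ρ n) := by
  induction v using Multiset.induction generalizing d ρ with
  | empty =>
    obtain rfl := Bind.zero_iff.1 h
    refine ⟨0, .zero, fun w hw => ⟨0, ?_, fun n => ?_⟩⟩
    · obtain rfl := Multiset.rel_zero_right.1 hw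
      exact .nil _
    · rw [Multiset.rel_zero_left.1 (hρ n)]
      exact .zero
  | cons p v ih =>
    obtain ⟨a, d, rfl, ha, hd⟩ := Bind.cons_iff.1 h
    obtain ⟨t, ht, ha⟩ := denSum_iff.1 ha
    rw [toEnv_add] at hρ
    obtain ⟨ρ₁, ρ₂, rfl, h₁, h₂⟩ := exists_rel_add hρ
    obtain ⟨Y, hY, h₃⟩ := ih hd h₂
    refine ⟨_, .cons (hN t ht a p ha ρ₁ h₁) hY, fun w hw => ?_⟩
    obtain ⟨q, w, ⟨Γ, ⟨t', ht', hq⟩, hΓ⟩, hw', rfl⟩ := Multiset.rel_cons_right.1 hw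
    obtain ⟨Δ, hΔ, h₄⟩ := h₃ w hw'
    exact ⟨Γ + Δ, .bang ht' hq hΔ, rel_add_env hΓ h₄⟩

/-- The fundamental lemma of the logical relation, one clause per constructor. Each copy of a
variable has its own set in `ρ`, and `ρ` is split along the typing rules just like an environment.
-/
theorem compatible_reducible : Compatible TermReducible BagReducible where
  var n := by
    intro s hs c α h ρ hρ
    obtain rfl := List.mem_singleton.1 hs
    rw [den] at h
    subst h
    rw [toEnv_singleton] at hρ
    have hn := hρ n
    rw [Pi.single_eq_same, ← Multiset.cons_zero, Multiset.rel_cons_left] at hn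
    obtain ⟨X, Z, hX, hZ, hXZ⟩ := hn
    obtain rfl := Multiset.rel_zero_left.1 hZ
    refine hX.mono ?_
    intro q hq
    refine ⟨Pi.single n {q}, ⟨.var n, by simp, .var n q⟩, fun m => ?_⟩
    by_cases hm : m = n
    · subst hm
      rw [hXZ, Pi.single_eq_same]
      exact .cons hq .zero
    · have hm' := hρ m
      rw [Pi.single_eq_of_ne hm] at hm' ⊢
      rw [Multiset.rel_zero_left.1 hm']
      exact .zero
  lam {M N} hMN := by
    intro s hs c α h ρ hρ
    obtain ⟨s, hs', rfl⟩ := List.mem_map.1 hs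
    obtain ⟨v, q, a, rfl, rfl, h⟩ := h
    refine reducible_cons.2 fun Y hY => ?_
    -- The arguments `Y` become the sets assigned to the bound variable; a point of the body then
    -- uses exactly one element from each of them.
    have := hMN s hs' _ _ h (fun n => Nat.casesOn n Y ρ) fun n => by
      cases n with
      | zero => simpa using hY
      | succ n => simpa using hρ n
    refine this.mono ?_
    rintro r ⟨Γ, hr, hΓ⟩
    refine ⟨Γ 0, hΓ 0, fun n => Γ (n + 1), mem_interp_lam.2 ⟨_, _, rfl, ?_⟩, fun n => hΓ (n + 1)⟩
    convert hr using 2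
    funext n
    cases n <;> rfl
  app {M N B C} hMN hBC := by
    intro s hs c α h ρ hρ
    simp only [Term.app, List.mem_flatMap, List.mem_map] at hs
    obtain ⟨s, hs, b, hb, rfl⟩ := hs
    obtain ⟨a, e, d, u, v, rfl, h₁, h₂, h₃⟩ := h
    rw [toEnv_tick, toEnv_add, toEnv_add, add_assoc] at hρ
    obtain ⟨ρ₁, ρ₂, rfl, hρ₁, hρ₂⟩ := exists_rel_add hρ
    obtain ⟨Y, hY, h₄⟩ := hBC b hb e d u v h₂ h₃ ρ₂ hρ₂
    refine (reducible_cons.1 (hMN s hs a _ h₁ ρ₁ hρ₁) Y hY).mono ?_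
    rintro q ⟨w, hw, Γ, hq, hΓ⟩
    obtain ⟨Δ, hΔ, h₅⟩ := h₄ w hw
    exact ⟨Γ + Δ, mem_interp_app.2 ⟨_, _, _, rfl, hq, hΔ⟩, rel_add_env hΓ h₅⟩
  nil := by
    intro s hs
    simp at hs
  add {M N M' N'} h h' := by
    intro s hs c α hc ρ hρ
    rcases List.mem_append.1 hs with hs | hs
    · refine (h s hs c α hc ρ hρ).mono ?_
      rintro q ⟨Γ, ⟨t, ht, hq⟩, hΓ⟩
      exact ⟨Γ, ⟨t, List.mem_append_left _ ht, hq⟩, hΓ⟩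
    · refine (h' s hs c α hc ρ hρ).mono ?_
      rintro q ⟨Γ, ⟨t, ht, hq⟩, hΓ⟩
      exact ⟨Γ, ⟨t, List.mem_append_right _ ht, hq⟩, hΓ⟩
  bag {L L' N N'} hL hN := by
    intro b hb e d u v he hd ρ hρ
    obtain ⟨l, hl, rfl⟩ := List.mem_map.1 hb
    simp only [mem_interpBag_mk]
    clear hb
    induction hL generalizing l e u ρ with
    | nil =>
      obtain rfl : l = [] := by simpa [List.sections] using hl
      obtain ⟨rfl, rfl⟩ := he
      rw [toEnv_zero, zero_add] at hρ
      obtain ⟨Y, hY, h⟩ := hN.bang hd hρ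
      refine ⟨Y, by rwa [zero_add], fun w hw => ?_⟩
      obtain ⟨Γ, hΓ, h⟩ := h w hw
      exact ⟨Γ, ⟨[], by simp [List.sections], hΓ⟩, h⟩
    | cons hM hL ih =>
      rcases List.mem_sections.1 hl with _ | ⟨hs, hm⟩
      obtain ⟨a, e, p, u, rfl, rfl, ha, he⟩ := he
      rw [toEnv_add, add_assoc] at hρ
      obtain ⟨ρ₁, ρ₂, rfl, h₁, h₂⟩ := exists_rel_add hρ
      obtain ⟨Y, hY, h⟩ := ih e u ρ₂ h₂ _ (List.mem_sections.2 hm) he hd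
      rw [Multiset.cons_add]
      refine ⟨_, .cons (hM _ hs a p ha ρ₁ h₁) hY, fun w hw => ?_⟩
      obtain ⟨q, w, ⟨Γ, ⟨t, ht, hq⟩, hΓ⟩, hw', rfl⟩ := Multiset.rel_cons_right.1 hw
      obtain ⟨Δ, ⟨m, hm, hΔ⟩, h₄⟩ := h w hw'
      exact ⟨Γ + Δ, exists_mem_sections_cons.2 ⟨t, ht, m, hm, .lin hq hΔ⟩, rel_add_env hΓ h₄⟩
  bagNil := by
    intro s hs
    simp at hs
  bagAdd {M N M' N'} h h' := by
    intro b hb e d u v he hd ρ hρ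
    rcases List.mem_append.1 hb with hb | hb
    · obtain ⟨Y, hY, h⟩ := h b hb e d u v he hd ρ hρ
      refine ⟨Y, hY, fun w hw => ?_⟩
      obtain ⟨Γ, ⟨t, ht, hq⟩, hΓ⟩ := h w hw
      exact ⟨Γ, ⟨t, List.mem_append_left _ ht, hq⟩, hΓ⟩
    · obtain ⟨Y, hY, h⟩ := h' b hb e d u v he hd ρ hρ
      refine ⟨Y, hY, fun w hw => ?_⟩
      obtain ⟨Γ, ⟨t, ht, hq⟩, hΓ⟩ := h w hw
      exact ⟨Γ, ⟨t, List.mem_append_right _ ht, hq⟩, hΓ⟩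

/-- Free variables of the filled context are given the set of all points, which is reducible of
every type; reducible sets are nonempty, and adequacy in `M∞` concludes. -/
theorem ObsLE.of_termReducible {M N : Term} (h : TermReducible M N) : ObsLE M N := by
  intro C hC hM
  obtain ⟨s, hs, c, α, hc⟩ := hM.exists_den freeModel
  have hr := compatible_reducible.plug h hC s hs c α hc
    (fun n => (toEnv c n).map fun _ => Set.univ) fun n => by
      rw [Multiset.rel_map_right]
      exact Multiset.rel_refl_of_refl_on fun α _ => (reducible_univ_and_nonempty α).1
  obtain ⟨q, Γ, hq, _⟩ := (reducible_univ_and_nonempty α).2 _ hr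
  exact Term.converges_iff.2 ⟨_, hq⟩

/-! ## The counter-example -/

theorem isResource_tmI : tmI.IsResource := .lam (.var 0)

theorem isResource_tmA : tmA.IsResource := by
  repeat' first
    | exact .var _
    | refine .app ?_ ?_ ?_
    | refine .lam ?_
    | refine List.forall_mem_cons.2 ⟨?_, ?_⟩
    | refine List.forall_mem_nil _

theorem freeBelow_tmI : tmI.FreeBelow 0 := .lam (.var (by norm_num))

theorem freeBelow_tmA : tmA.FreeBelow 0 := by
  repeat' first
    | exact .var (by norm_num)
    | refine .app ?_ ?_ ?_
    | refine .lam ?_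
    | refine List.forall_mem_cons.2 ⟨?_, ?_⟩
    | refine List.forall_mem_nil _

theorem termReducible_tmI_tmA : TermReducible [tmI] [tmA] := by
  intro s hs c α h ρ hρ
  obtain rfl := List.mem_singleton.1 hs
  obtain ⟨v, β, a, rfl, rfl, h⟩ := h
  rw [den] at h
  have h0 := congrArg toEnv h
  rw [toEnv_singleton] at h0
  -- The only free types of `I` are `[β] → β`, so it remains to show that `A` maps a reducible set
  -- of type `β` to one; its image contains all delays of the points of that set.
  obtain rfl : v = {β} := by simpa using congr_fun h0 0
  refine reducible_cons.2 fun Y hY => ?_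
  rw [← Multiset.cons_zero, Multiset.rel_cons_left] at hY
  obtain ⟨X, Z, hX, hZ, rfl⟩ := hY
  obtain rfl := Multiset.rel_zero_left.1 hZ
  refine hX.delay.mono ?_
  rintro q ⟨p, hp, hq⟩
  refine ⟨{p}, .cons hp .zero, 0, ⟨_, by simp, HasType.tmA hq⟩, fun n => ?_⟩
  have hn : toEnv a n = 0 := by simpa using congr_fun h0 (n + 1)
  have := hρ n
  rw [toEnv_tick, hn, Multiset.rel_zero_left] at this
  rw [this]
  exact .zero

theorem obsLE_tmI_tmA : ObsLE [tmI] [tmA] := .of_termReducible termReducible_tmI_tmA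

theorem obsEquiv_add : ObsEquiv [tmA, tmI] [tmA] := by
  refine ⟨.of_termReducible ?_, .of_interp_subset ?_⟩
  · have hA := compatible_reducible.simple_refl isResource_tmA
    intro s hs
    simp only [List.mem_cons, List.not_mem_nil, or_false] at hs
    rcases hs with rfl | rfl
    · exact hA _ (by simp)
    · exact termReducible_tmI_tmA _ (by simp)
  · rintro p ⟨s, hs, h⟩
    exact ⟨s, List.mem_cons.2 (.inl (List.mem_singleton.1 hs)), h⟩

theorem interp_add_ne : interp [tmA, tmI] ≠ interp [tmA] := by
  intro h
  -- The separating point is `[*] :: *`.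
  have hI : ((0 : Env), MInf.cons {.star} .star) ∈ interp [tmA, tmI] :=
    ⟨tmI, by simp, HasType.tmI _⟩
  rw [h] at hI
  obtain ⟨s, hs, hA⟩ := hI
  obtain rfl := List.mem_singleton.1 hs
  obtain ⟨c, _, hc⟩ := hA.exists_den
  exact not_den_tmA hc

theorem not_obsLETests : ¬ ObsLETests [tmI] [tmA] := by
  intro h
  -- The test is `τ(I [τ̄(ε)!])`, which reduces to `τ(τ̄(ε))` and then to `ε`. With `A` in place of
  -- `I`, typability would require a type `v :: *` of `A`.
  have hI : Test.Converges [[.app tmI [] [.taubar []]]] :=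
    ⟨[[]], .head (.mk [] [] (.head [] [] (.beta _ _ _)))
      (.single (.mk [] [] (.gamma [] [] []))), [], by simp, by simp [STest.Normal]⟩
  obtain ⟨Q, hQ, c, hc⟩ :=
    (h.2 (.tau (.appLeft .hole [([], [.taubar []])])) hI).exists_denTest mInf
  obtain rfl := List.mem_singleton.1 hQ
  obtain ⟨_, _, _, rfl, rfl, ⟨a, _, _, _, _, _, ha, _⟩, _⟩ := denTest_cons.1 hc
  exact not_den_tmA ha

end ResourceCalculus

theorem mainTheorem1 :
    -- `M∞` is not fully abstract for the λ-calculus with resources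
    ¬ FullyAbstract
    -- denotational equality implies observational equivalence ...
    ∧ (∀ M N : Term, M.IsResource → N.IsResource → interp M = interp N → ObsEquiv M N)
    -- ... but not conversely: `A + I` and `A` are closed, observationally equivalent and have
    -- different interpretations
    ∧ (Term.IsResource [tmA, tmI] ∧ Term.IsClosed [tmA, tmI]
      ∧ ObsEquiv [tmA, tmI] [tmA] ∧ interp [tmA, tmI] ≠ interp [tmA])
    -- `A` is observationally above `I` without tests, but not with tests
    ∧ ObsLE [tmI] [tmA]
    ∧ ¬ ObsLETests [tmI] [tmA] := by
  have hR : Term.IsResource [tmA, tmI] := by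
    simpa [Term.IsResource] using ⟨isResource_tmA, isResource_tmI⟩
  have hC : Term.IsClosed [tmA, tmI] := by
    simpa [Term.IsClosed] using ⟨freeBelow_tmA, freeBelow_tmI⟩
  refine ⟨fun h => interp_add_ne ?_, fun M N _ _ h => ⟨.of_interp_subset h.le,
    .of_interp_subset h.ge⟩, ⟨hR, hC, obsEquiv_add, interp_add_ne⟩, obsLE_tmI_tmA, not_obsLETests⟩
  refine (h _ _ hR hC ?_ ?_).2 obsEquiv_add
  · simpa [Term.IsResource] using isResource_tmA
  · simpa [Term.IsClosed] using freeBelow_tmA
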